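/- Let $\Omega\subset\mathbb{R}^d$ be a compact domain (the closure of a bounded connected open set) with Lebesgue-null boundary and $|\Omega|=1$; let $T>0$, $\alpha,\beta>0$, $\delta_1,\delta_2>0$ and $V=(V_1,V_2)\in C^1(\Omega,\mathbb{R}^2)$. Put $w=\frac{1}{\alpha+\beta}(\beta,\alpha)$, $Z=\sum_{i}\int_\Omega w_i e^{-V_i}\,dx$, $w_i^V=\frac1Z w_ie^{-V_i}$. Let $Q=\mathrm{Prob}(\Omega\times\{1,2\})$, i.e. pairs $\mu=(\mu_1,\mu_2)$ of nonnegative measures on $\Omega$ with $\mu_1(\Omega)+\mu_2(\Omega)=1$, and let $\mathrm{L}^\infty_w([0,T],Q)$ be the set of weak-* measurable curves $t\mapsto\mu(t)$ with values in $Q$ for a.e. $t$. With $E_B(r)=r\log r-r+1$ define $\mathcal{E}(\mu)=\int_\Omega\sum_{j}E_B(c_j/w_j)\,w_j\,dx$ if $\mu=c\,dx$, and $\mathcal{E}(\mu)=\infty$ otherwise. For $\varepsilon>0$ and a trajectory $\mu\in \mathrm{L}^\infty_w([0,T],Q)$ that has a representative in $\mathrm{AC}([0,T],Q)$ ($Q$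 with the $1$-Wasserstein distance) and satisfies $\mu(t)=c(t,\cdot)\,dx$ for a.e. $t$, put, with $\rho_j^V=c_j/w_j^V$, $$\mathfrak{D}^V_\varepsilon(\mu)=\inf_{(J,b)}\int_0^T\!\!\int_\Omega\Big\{\sum_{j=1}^2\widetilde{\mathsf Q}(\delta_jc_j,J_j)+\widetilde{\mathsf C}\Big(\tfrac{\sqrt{c_1c_2}}{\varepsilon},b_2\Big)\Big\}dx\,dt+\int_0^T\!\!\int_\Omega\Big\{\frac12\sum_{j=1}^2\delta_jw_j^V\frac{|\nabla\rho_j^V|^2}{\rho_j^V}+\frac2\varepsilon\sqrt{w_1^Vw_2^V}\Big(\sqrt{\rho_1^V}-\sqrt{\rho_2^V}\Big)^2\Big\}dx\,dt,$$ and $\mathfrak{D}^V_\varepsilon(\mu)=\infty$ for all other trajectories. Here $\nabla$ is the weak spatial gradient in the interior of $\Omega$ (the gradient term is $\infty$ if it does not exist as an $L^1$ function); $\widetilde{\mathsf F}(a,x)=a\,\mathsf F(x/a)$ for $a>0$, $\widetilde{\mathsf F}(0,0)=0$, and $\widetilde{\mathsf F}(0,x)=\infty$ for $x\ne0$; $\mathsf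 Q(x)=\frac12|x|^2$; $\mathsf C$ is the Legendre transform of $\mathsf C^*(s)=4(\cosh(s/2)-1)$; and the infimum runs over $L^1$ fluxes $J_j:[0,T]\times\Omega\to\mathbb{R}^d$, $b_j:[0,T]\times\Omega\to\mathbb{R}$ with $b_1+b_2=0$ that satisfy $\dot c_j=-\operatorname{div}J_j+b_j$ in the sense of distributions on $]0,T[\,\times\Omega$, with $J_j\cdot\nu=0$ on $\partial\Omega$ in the weak sense (test functions need not vanish on $\partial\Omega$). Let $\varepsilon_n>0$ with $\varepsilon_n\to0$, and let $\mu^{\varepsilon_n}\in\mathrm{L}^\infty_w([0,T],Q)$ satisfy, for some constant $C<\infty$, $$\sup_n\ \operatorname*{ess\,sup}_{t\in[0,T]}\mathcal{E}(\mu^{\varepsilon_n}(t))\le C,\qquad \sup_n\ \mathfrak{D}^V_{\varepsilon_n}(\mu^{\varepsilon_n})\le C .$$ Then the trajectories $\mu^{\varepsilon_n}$ have Lebesgue densities $c^{\varepsilon_n}=(c_1^{\varepsilon_n},c_2^{\varepsilon_n})$, and there are a subsequence (not relabelled) and a trajectory $\mu^0=c^0\,dx\in\mathrm{L}^\infty_w([0,T],Q)$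 such that $c_i^{\varepsilon_n}\to c_i^0$ strongly in $L^1([0,T]\times\Omega)$ for $i=1,2$. Moreover, with $\rho_i^{V,0}=c_i^0/w_i^V$, we have $\rho_1^{V,0}=\rho_2^{V,0}$ a.e. in $[0,T]\times\Omega$. -/

import Mathlib

open MeasureTheory Filter Topology Set
open scoped ENNReal NNReal ContDiff

noncomputable section

namespace FastReaction

/-- The Euclidean space `ℝ^d`. -/
abbrev Space (d : ℕ) : Type := EuclideanSpace ℝ (Fin d)

/-- A compact domain: the closure of a bounded connected open set, with Lebesgue-null boundary
(as is the case for every bounded Lipschitz domain). -/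
structure IsCompactDomain {d : ℕ} (Ω : Set (Space d)) : Prop where
  isCompact : IsCompact Ω
  connected_interior : IsConnected (interior Ω)
  closure_interior : closure (interior Ω) = Ω
  volume_frontier : volume (frontier Ω) = 0

/-- `f ∈ C¹(Ω)` for a compact domain `Ω`: `f` is continuous on `Ω`, differentiable in the interior,
and its derivative extends continuously to `Ω`. Values of `f` outside `Ω` are irrelevant. -/
def IsC1On {d : ℕ} (Ω : Set (Space d)) (f : Space d → ℝ) : Prop :=
  ContinuousOn f Ω ∧ ∃ f' : Space d → (Space d →L[ℝ] ℝ), ContinuousOn f' Ω ∧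
    ∀ x ∈ interior Ω, HasFDerivAt f (f' x) x

/-! ### State space, trajectories, densities -/

/-- `μ = (μ₁, μ₂)` belongs to `Q = Prob(Ω × {1,2})`: two nonnegative measures carried by `Ω`
whose total masses add up to one. The species `1, 2` are indexed by `0, 1 : Fin 2`. -/
def IsState {d : ℕ} (Ω : Set (Space d)) (μ : Fin 2 → Measure (Space d)) : Prop :=
  (∀ i, μ i Ωᶜ = 0) ∧ ∑ i, μ i Ω = 1

/-- `μ ∈ L^∞_w([0,T], Q)`: a weak-* measurable curve, with values in `Q` for a.e. time. -/
def IsTrajectory {d : ℕ} (Ω : Set (Space d)) (T : ℝ)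
    (μ : ℝ → Fin 2 → Measure (Space d)) : Prop :=
  (∀ᵐ t ∂(volume.restrict (Icc 0 T)), IsState Ω (μ t)) ∧
  ∀ (i : Fin 2) (f : Space d → ℝ), Continuous f →
    AEMeasurable (fun t => ∫ x, f x ∂(μ t i)) (volume.restrict (Icc 0 T))

/-- Lebesgue measure on the space-time cylinder `[0,T] × Ω`. -/
def spaceTime {d : ℕ} (Ω : Set (Space d)) (T : ℝ) : Measure (ℝ × Space d) :=
  volume.restrict (Icc 0 T ×ˢ Ω)

/-- `c = (c₁, c₂)` is a Lebesgue density of the trajectory `μ`, i.e. `μ(t) = c(t,·) dx` for a.e.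
`t ∈ [0,T]`. Such a `c` is unique up to null sets of `[0,T] × Ω`. -/
def IsDensity {d : ℕ} (Ω : Set (Space d)) (T : ℝ) (μ : ℝ → Fin 2 → Measure (Space d))
    (c : Fin 2 → ℝ × Space d → ℝ) : Prop :=
  (∀ i, Measurable (c i)) ∧ (∀ i p, 0 ≤ c i p) ∧
  ∀ᵐ t ∂(volume.restrict (Icc 0 T)), ∀ i,
    μ t i = (volume.restrict Ω).withDensity (fun x => ENNReal.ofReal (c i (t, x)))

/-! ### Wasserstein distance and absolutely continuous curves -/

/-- The measure on `ℝ^d × {1,2}` given by the pair `(μ₁, μ₂)`. -/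
def joinSpecies {d : ℕ} (μ : Fin 2 → Measure (Space d)) : Measure (Space d × Fin 2) :=
  ∑ i, (μ i).map (fun x => (x, i))

/-- Euclidean distance on `ℝ^d × {1,2} ⊆ ℝ^{d+1}`. -/
def speciesDist {d : ℕ} (p q : Space d × Fin 2) : ℝ :=
  Real.sqrt (dist p.1 q.1 ^ 2 + (((p.2 : ℕ) : ℝ) - ((q.2 : ℕ) : ℝ)) ^ 2)

/-- The `1`-Wasserstein distance on `Prob(Ω × {1,2})`: infimum of the transport cost over all
transport plans. -/
def wasserstein {d : ℕ} (μ ν : Fin 2 → Measure (Space d)) : ℝ≥0∞ :=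
  ⨅ (γ : Measure ((Space d × Fin 2) × (Space d × Fin 2)))
    (_ : γ.map Prod.fst = joinSpecies μ) (_ : γ.map Prod.snd = joinSpecies ν),
    ∫⁻ z, ENNReal.ofReal (speciesDist z.1 z.2) ∂γ

/-- `μ ∈ AC([0,T], Q)`: the (a.e. defined) trajectory `μ` has a representative which is an
absolutely continuous curve with values in `Q` equipped with the `1`-Wasserstein distance. -/
def IsAC {d : ℕ} (Ω : Set (Space d)) (T : ℝ) (μ : ℝ → Fin 2 → Measure (Space d)) : Prop :=
  ∃ ν : ℝ → Fin 2 → Measure (Space d),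
    (∀ᵐ t ∂(volume.restrict (Icc 0 T)), ν t = μ t) ∧
    (∀ t ∈ Icc 0 T, IsState Ω (ν t)) ∧
    ∃ m : ℝ → ℝ, IntegrableOn m (Icc 0 T) ∧
      ∀ s ∈ Icc 0 T, ∀ t ∈ Icc 0 T, s ≤ t →
        wasserstein (ν s) (ν t) ≤ ENNReal.ofReal (∫ r in s..t, m r)

/-! ### Energy and stationary measures -/

/-- Boltzmann function `E_B(r) = r log r - r + 1` (with `E_B(0) = 1`). -/
def boltzmann (r : ℝ) : ℝ := r * Real.log r - r + 1

/-- The stationary vector `w = (β, α)/(α+β)`. -/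
def statVec (α β : ℝ) : Fin 2 → ℝ := ![β / (α + β), α / (α + β)]

open Classical in
/-- The free energy `∫_Ω ∑ⱼ E_B(cⱼ/wⱼ) wⱼ dx` if `μ = c dx`, and `∞` otherwise. -/
def energy {d : ℕ} (Ω : Set (Space d)) (α β : ℝ) (μ : Fin 2 → Measure (Space d)) : ℝ≥0∞ :=
  if ∀ i, μ i ≪ volume.restrict Ω then
    ∑ i, ∫⁻ x in Ω, ENNReal.ofReal
      (boltzmann (((μ i).rnDeriv (volume.restrict Ω) x).toReal / statVec α β i) * statVec α β i)
  else ∞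

/-- The normalisation constant `Z = ∑ᵢ ∫_Ω wᵢ exp(-Vᵢ) dx`. -/
def partitionConst {d : ℕ} (Ω : Set (Space d)) (α β : ℝ) (V : Fin 2 → Space d → ℝ) : ℝ :=
  ∑ i, ∫ x in Ω, statVec α β i * Real.exp (-V i x)

/-- The tilted stationary density `wᵢ^V = Z⁻¹ wᵢ exp(-Vᵢ)`. -/
def tiltedStat {d : ℕ} (Ω : Set (Space d)) (α β : ℝ) (V : Fin 2 → Space d → ℝ)
    (i : Fin 2) (x : Space d) : ℝ :=
  (partitionConst Ω α β V)⁻¹ * (statVec α β i * Real.exp (-V i x))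

/-- The relative density `ρᵢ^V = cᵢ / wᵢ^V`. -/
def relDensity {d : ℕ} (Ω : Set (Space d)) (α β : ℝ) (V : Fin 2 → Space d → ℝ)
    (c : Fin 2 → ℝ × Space d → ℝ) (i : Fin 2) (p : ℝ × Space d) : ℝ :=
  c i p / tiltedStat Ω α β V i p.2

/-! ### The dissipation functional -/

open Classical in
/-- For `F : E → [0,∞]` the function `F̃(a,x) = a F(x/a)` for `a > 0`, and `F̃(0,x) = 0` if `x = 0`,
`F̃(0,x) = ∞` if `x ≠ 0`. -/
def perspective {E : Type*} [AddCommGroup E] [Module ℝ E] (F : E → ℝ≥0∞) (a : ℝ) (x : E) : ℝ≥0∞ :=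
  if 0 < a then ENNReal.ofReal a * F (a⁻¹ • x) else if x = 0 then 0 else ∞

/-- `Q(x) = |x|²/2`. -/
def quad {d : ℕ} (x : Space d) : ℝ≥0∞ := ENNReal.ofReal (‖x‖ ^ 2 / 2)

/-- `C*(s) = 4 (cosh(s/2) - 1)`. -/
def coshStar (s : ℝ) : ℝ := 4 * (Real.cosh (s / 2) - 1)

/-- The Legendre transform `C(r) = sup_s (r s - C*(s))`. It is nonnegative (take `s = 0`), so the
supremum may be taken in `[0,∞]`. -/
def coshDual (r : ℝ) : ℝ≥0∞ := ⨆ s : ℝ, ENNReal.ofReal (r * s - coshStar s)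

/-- The generalized continuity equation `ċⱼ = -div Jⱼ + bⱼ`, `b₁ + b₂ = 0`, in the sense of
distributions, for fluxes `Jⱼ`, `bⱼ` in `L¹([0,T] × Ω)`. Test functions vanish near `t = 0` and
`t = T`, but not near `∂Ω`; this encodes the no-flux condition `J · ν = 0` on `∂Ω`. -/
def GCE {d : ℕ} (Ω : Set (Space d)) (T : ℝ) (c : Fin 2 → ℝ × Space d → ℝ)
    (J : Fin 2 → ℝ × Space d → Space d) (b : Fin 2 → ℝ × Space d → ℝ) : Prop :=
  (∀ j, Integrable (J j) (spaceTime Ω T)) ∧ (∀ j, Integrable (b j) (spaceTime Ω T)) ∧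
  (∀ᵐ p ∂(spaceTime Ω T), b 0 p + b 1 p = 0) ∧
  ∀ (j : Fin 2) (φ : ℝ × Space d → ℝ), ContDiff ℝ ∞ φ → HasCompactSupport φ →
    tsupport φ ⊆ Ioo 0 T ×ˢ univ →
    ∫ p, (fderiv ℝ φ p (1, 0) * c j p + fderiv ℝ φ p (0, J j p)) ∂(spaceTime Ω T) =
      - ∫ p, b j p * φ p ∂(spaceTime Ω T)

/-- The velocity part
`∫₀ᵀ ∫_Ω ∑ⱼ Q̃(δⱼ cⱼ, Jⱼ) dx + ∫_Ω C̃(√(c₁ c₂)/ε, b₂) dx dt` for given fluxes. -/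
def velocityPart {d : ℕ} (Ω : Set (Space d)) (T : ℝ) (δ : Fin 2 → ℝ) (ε : ℝ)
    (c : Fin 2 → ℝ × Space d → ℝ) (J : Fin 2 → ℝ × Space d → Space d)
    (b : Fin 2 → ℝ × Space d → ℝ) : ℝ≥0∞ :=
  (∑ j, ∫⁻ p, perspective quad (δ j * c j p) (J j p) ∂(spaceTime Ω T)) +
    ∫⁻ p, perspective coshDual (Real.sqrt (c 0 p * c 1 p) / ε) (b 1 p) ∂(spaceTime Ω T)

/-- `G ∈ L¹` is the weak spatial gradient of `ρ` on `]0,T[ × int Ω`. -/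
def IsWeakGradient {d : ℕ} (Ω : Set (Space d)) (T : ℝ) (ρ : ℝ × Space d → ℝ)
    (G : ℝ × Space d → Space d) : Prop :=
  Integrable G (spaceTime Ω T) ∧
  ∀ φ : ℝ × Space d → ℝ, ContDiff ℝ ∞ φ → HasCompactSupport φ →
    tsupport φ ⊆ Ioo 0 T ×ˢ interior Ω → ∀ v : Space d,
    ∫ p, ρ p * fderiv ℝ φ p (0, v) ∂(spaceTime Ω T) =
      - ∫ p, inner ℝ (G p) v * φ p ∂(spaceTime Ω T)

/-- The diffusive slope `∫₀ᵀ ½ ∫_Ω δⱼ wⱼ^V |∇ρⱼ^V|²/ρⱼ^V dx dt` of species `j`. It is `∞` if `ρⱼ^V`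
has no weak spatial gradient; the gradient is unique up to null sets when it exists.
Note that `½ |∇ρ|²/ρ = Q̃(ρ, ∇ρ)`. -/
def diffusiveSlope {d : ℕ} (Ω : Set (Space d)) (T α β : ℝ) (δ : Fin 2 → ℝ)
    (V : Fin 2 → Space d → ℝ) (c : Fin 2 → ℝ × Space d → ℝ) (j : Fin 2) : ℝ≥0∞ :=
  ⨅ (G : ℝ × Space d → Space d) (_ : IsWeakGradient Ω T (relDensity Ω α β V c j) G),
    ∫⁻ p, ENNReal.ofReal (δ j * tiltedStat Ω α β V j p.2) *
      perspective quad (relDensity Ω α β V c j p) (G p) ∂(spaceTime Ω T)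

/-- The reactive slope `∫₀ᵀ (2/ε) ∫_Ω √(w₁^V w₂^V) (√ρ₁^V - √ρ₂^V)² dx dt`. -/
def reactiveSlope {d : ℕ} (Ω : Set (Space d)) (T α β ε : ℝ)
    (V : Fin 2 → Space d → ℝ) (c : Fin 2 → ℝ × Space d → ℝ) : ℝ≥0∞ :=
  ENNReal.ofReal (2 / ε) * ∫⁻ p, ENNReal.ofReal
    (Real.sqrt (tiltedStat Ω α β V 0 p.2 * tiltedStat Ω α β V 1 p.2) *
      (Real.sqrt (relDensity Ω α β V c 0 p) - Real.sqrt (relDensity Ω α β V c 1 p)) ^ 2)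
    ∂(spaceTime Ω T)

/-- The total dissipation functional `𝔇_ε^V(μ)`. For `μ ∈ AC([0,T], Q)` with `μ = c dx` a.e. in
`[0,T]` it is the infimum of the velocity part over all fluxes satisfying the generalized continuity
equation, plus the slope part. Otherwise it is `∞` (an infimum over the empty set). The outer infimum
only selects the density `c`, on whose a.e. representative the value does not depend. -/
def dissipation {d : ℕ} (Ω : Set (Space d)) (T α β : ℝ) (δ : Fin 2 → ℝ)
    (V : Fin 2 → Space d → ℝ) (ε : ℝ) (μ : ℝ → Fin 2 → Measure (Space d)) : ℝ≥0∞ :=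
  ⨅ (_ : IsAC Ω T μ) (c : Fin 2 → ℝ × Space d → ℝ) (_ : IsDensity Ω T μ c),
    (⨅ (J : Fin 2 → ℝ × Space d → Space d) (b : Fin 2 → ℝ × Space d → ℝ) (_ : GCE Ω T c J b),
      velocityPart Ω T δ ε c J b) +
    ((∑ j, diffusiveSlope Ω T α β δ V c j) + reactiveSlope Ω T α β ε V c)

end FastReaction

end

/-! ### Duality tools in `L¹`: smooth test functions, translations, weak convergence. -/

namespace FastReaction

/-! The argument is an Aubin–Lions compactness proof carried out by duality. The dissipation bound
gives three estimates uniform in `ε`: the fluxes `J` are bounded in `L¹`, the weak gradient of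
`ρ₁^V` is bounded in `L¹`, and `‖ρ₁^V - ρ₂^V‖_{L¹} ≤ M √ε` (`exists_uniform_estimates`). The energy
bound gives equi-integrability, so no mass escapes to the boundary of the cylinder
(`exists_measure_le_setIntegral_relDensity_le`).

Space regularity of `ρ₁^V` comes from its gradient. Time regularity cannot be read off the equation
for a single species without controlling the reaction flux as `ε → 0`. In the equation for `c₁ + c₂`
the reaction fluxes cancel, and `J` alone controls its time translations in a dual Lipschitz norm.
Since `ρ₁^V` and `ρ₂^V` are close, `c₁ + c₂` is close to `(w₁^V + w₂^V) ρ₁^V`, and this passes the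
time regularity on to `ρ₁^V` up to an error vanishing with `ε`.

The compactness criterion `exists_subseq_tendsto_integral_abs_sub` combines these facts. To estimate
`‖f_n - f_k‖_{L¹}` on a compact set, pair with a smooth `Ψ` approximating the sign of the
difference. Mollifying `Ψ` in space costs little by the gradient bound and makes it Lipschitz in
space with a constant independent of `Ψ`; mollifying then in time costs little by the continuity
equation. By Fubini the remaining kernel acts on `f_n - f_k`, where weak convergence becomes strong.

The limit `f₀` of `ρ₁^V` is also the limit of `ρ₂^V`, which gives strong convergence of both `c_i =
w_i^V ρ_i^V` and equality of the limiting relative densities. -/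

open ContinuousLinearMap in
/-- On a compact set, the `L¹` norm of `f` is almost attained by testing against a smooth function
of modulus at most one, supported in a given thickening of the set. -/
theorem exists_smooth_setIntegral_abs_le {Z : Type*} [NormedAddCommGroup Z] [NormedSpace ℝ Z]
    [FiniteDimensional ℝ Z] [MeasurableSpace Z] [BorelSpace Z] (ν : Measure Z) [ν.IsAddHaarMeasure]
    {m : Measure Z} (hm : m ≪ ν) {f : Z → ℝ} (hf : Integrable f m) {K : Set Z} (hK : IsCompact K)
    {r κ : ℝ} (hr : 0 < r) (hκ : 0 < κ) :
    ∃ Ψ : Z → ℝ, ContDiff ℝ ∞ Ψ ∧ tsupport Ψ ⊆ Metric.cthickening r K ∧ (∀ z, |Ψ z| ≤ 1) ∧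
      ∫ z in K, |f z| ∂m ≤ ∫ z, f z * Ψ z ∂m + κ := by
  set f' := hf.1.mk f with hf'
  have hf'm : Measurable f' := hf.1.stronglyMeasurable_mk.measurable
  -- The sign of a measurable representative of `f`, cut off to `K`, attains the norm exactly;
  -- mollifying it gives the smooth test functions.
  set s : Z → ℝ := K.indicator (fun z => if 0 ≤ f' z then 1 else -1) with hs
  have hsm : Measurable s :=
    (Measurable.ite (measurableSet_le measurable_const hf'm) measurable_const
      measurable_const).indicator hK.measurableSet
  have hs1 : ∀ z, |s z| ≤ 1 := by
    intro z
    by_cases hz : z ∈ K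
    · simp only [hs, indicator_of_mem hz]; split_ifs <;> simp
    · simp [hs, indicator_of_notMem hz]
  have hsK : Function.support s ⊆ K := support_indicator_subset
  have hsl : LocallyIntegrable s ν := by
    refine (Integrable.mono' (g := K.indicator fun _ => (1 : ℝ)) ?_ hsm.aestronglyMeasurable
      (Eventually.of_forall fun z => ?_)).locallyIntegrable
    · exact (integrable_indicator_iff hK.measurableSet).2
        (integrableOn_const hK.measure_lt_top.ne)
    · by_cases hz : z ∈ K
      · simpa [indicator_of_mem hz] using hs1 z
      · simp [hs, indicator_of_notMem hz]
  -- The fixed ratio 2 between the radii is what a.e. convergence at Lebesgue points requires; outer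
  -- radii at most `r` keep the supports in the thickening.
  let φ : ℕ → ContDiffBump (0 : Z) := fun i =>
    { rIn := r / 2 / (i + 1)
      rOut := r / (i + 1)
      rIn_pos := by positivity
      rIn_lt_rOut := by gcongr; linarith }
  have hφ0 : Tendsto (fun i => (φ i).rOut) atTop (𝓝 0) := by
    have := (tendsto_one_div_add_atTop_nhds_zero_nat (𝕜 := ℝ)).const_mul r
    simpa [φ, div_eq_mul_inv] using this
  have hφr : ∀ i, (φ i).rOut ≤ r := fun i => by
    refine div_le_self hr.le ?_
    have : (0 : ℝ) ≤ i := by positivity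
    linarith
  set g : ℕ → Z → ℝ := fun i => MeasureTheory.convolution ((φ i).normed ν) s (lsmul ℝ ℝ) ν with hg
  have hgc : ∀ i, ContDiff ℝ ∞ (g i) := fun i =>
    ((φ i).hasCompactSupport_normed (μ := ν)).contDiff_convolution_left _ (φ i).contDiff_normed hsl
  have hg1 : ∀ i z, |g i z| ≤ 1 := by
    intro i z
    simp only [hg, convolution_def, lsmul_apply]
    rw [← Real.norm_eq_abs]
    refine (norm_integral_le_of_norm_le ((φ i).integrable_normed (μ := ν))
      (Eventually.of_forall fun t => ?_)).trans_eq ((φ i).integral_normed)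
    rw [smul_eq_mul, norm_mul, Real.norm_of_nonneg ((φ i).nonneg_normed _)]
    exact mul_le_of_le_one_right ((φ i).nonneg_normed _) (hs1 _)
  have hgs : ∀ i, tsupport (g i) ⊆ Metric.cthickening r K := by
    intro i
    refine closure_minimal ((support_convolution_subset (lsmul ℝ ℝ)).trans ?_)
      Metric.isClosed_cthickening
    rintro _ ⟨a, ha, b, hb, rfl⟩
    rw [(φ i).support_normed_eq, mem_ball_zero_iff] at ha
    refine Metric.mem_cthickening_of_dist_le _ b r K (hsK hb) ?_
    simpa [dist_eq_norm] using ha.le.trans (hφr i)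
  have hae : ∀ᵐ z ∂m, Tendsto (fun i => g i z) atTop (𝓝 (s z)) :=
    hm.ae_le (ContDiffBump.ae_convolution_tendsto_right_of_locallyIntegrable hφ0 (K := 2)
      (Eventually.of_forall fun i => by simp only [φ]; apply le_of_eq; field_simp) hsl)
  have hlim : Tendsto (fun i => ∫ z, f z * g i z ∂m) atTop (𝓝 (∫ z, f z * s z ∂m)) := by
    refine tendsto_integral_of_dominated_convergence (fun z => |f z|)
      (fun i => hf.1.mul (hgc i).continuous.aestronglyMeasurable) hf.abs
      (fun i => Eventually.of_forall fun z => ?_) ?_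
    · rw [norm_mul]; exact mul_le_of_le_one_right (norm_nonneg _) (hg1 i z)
    · filter_upwards [hae] with z hz using hz.const_mul _
  have hsf : ∫ z, f z * s z ∂m = ∫ z in K, |f z| ∂m := by
    rw [← integral_indicator hK.measurableSet]
    refine integral_congr_ae ?_
    filter_upwards [hf.1.ae_eq_mk] with z hz
    by_cases hzK : z ∈ K
    · simp only [hs, indicator_of_mem hzK, hf', ← hz]
      split_ifs with h
      · rw [abs_of_nonneg h, mul_one]
      · rw [abs_of_neg (not_le.1 h)]; ring
    · simp [hs, indicator_of_notMem hzK]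
  rw [hsf] at hlim
  obtain ⟨i, hi⟩ := (hlim.eventually (lt_mem_nhds (b := ∫ z in K, |f z| ∂m)
    (a := ∫ z in K, |f z| ∂m - κ) (by linarith))).exists
  exact ⟨g i, hgc i, hgs i, hg1 i, by linarith⟩

/-- Averaging a family of test functions does not increase the pairing with `f`. -/
theorem abs_integral_mul_average_le {Z P : Type*} [MeasurableSpace Z] [MeasurableSpace P]
    {m : Measure Z} {ν : Measure P} [SFinite m] [SFinite ν] {f : Z → ℝ} (hf : Integrable f m)
    {k : P → ℝ} (hk : Integrable k ν) (hk0 : ∀ p, 0 ≤ k p) (hk1 : ∫ p, k p ∂ν = 1)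
    {H : Z → P → ℝ} (hH : Measurable (Function.uncurry H)) {B : ℝ} (hB : ∀ z p, |H z p| ≤ B) {C : ℝ}
    (hC : ∀ p, k p ≠ 0 → |∫ z, f z * H z p ∂m| ≤ C) :
    |∫ z, f z * ∫ p, k p * H z p ∂ν ∂m| ≤ C := by
  have hint : Integrable (Function.uncurry fun z p => f z * (k p * H z p)) (m.prod ν) := by
    have := (hf.mul_prod hk).mul_bdd (g := Function.uncurry H) (c := B) hH.aestronglyMeasurable
      (Eventually.of_forall fun q => hB q.1 q.2)
    refine this.congr (Eventually.of_forall fun q => ?_)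
    simp [Function.uncurry, mul_assoc]
  have h1 : ∫ z, f z * ∫ p, k p * H z p ∂ν ∂m = ∫ p, k p * ∫ z, f z * H z p ∂m ∂ν := by
    simp_rw [← integral_const_mul]
    rw [integral_integral_swap hint]
    refine integral_congr_ae (Eventually.of_forall fun p => ?_)
    refine integral_congr_ae (Eventually.of_forall fun z => ?_)
    simp only; ring
  rw [h1, ← Real.norm_eq_abs]
  refine (norm_integral_le_of_norm_le (hk.mul_const C) (Eventually.of_forall fun p => ?_)).trans_eq
    (by rw [integral_mul_const, hk1, one_mul])
  rw [norm_mul, Real.norm_of_nonneg (hk0 p)]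
  by_cases h : k p = 0
  · simp [h]
  · exact mul_le_mul_of_nonneg_left (hC p h) (hk0 p)

/-- Fundamental theorem of calculus for translations of a test function, paired with `f`. -/
theorem abs_integral_mul_translate_sub_le {Z : Type*} [NormedAddCommGroup Z] [NormedSpace ℝ Z]
    [MeasurableSpace Z] [BorelSpace Z] {m : Measure Z} {f : Z → ℝ} (hf : Integrable f m)
    {Ψ : Z → ℝ} (hΨ : ContDiff ℝ ∞ Ψ) (hc : HasCompactSupport Ψ) (v : Z) {C : ℝ}
    (hC : ∀ r ∈ Icc (0 : ℝ) 1, |∫ z, f z * fderiv ℝ Ψ (z - r • v) v ∂m| ≤ C) :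
    |∫ z, f z * (Ψ (z - v) - Ψ z) ∂m| ≤ C := by
  have hdc : Continuous (fderiv ℝ Ψ) := hΨ.continuous_fderiv (by simp)
  obtain ⟨D, hD⟩ := (hc.fderiv (𝕜 := ℝ)).exists_bound_of_continuous hdc
  obtain ⟨B, hB⟩ := hc.exists_bound_of_continuous hΨ.continuous
  have hint : ∀ r : ℝ, Integrable (fun z => f z * Ψ (z - r • v)) m := fun r =>
    hf.mul_bdd (c := B) (hΨ.continuous.comp (by fun_prop)).aestronglyMeasurable
      (Eventually.of_forall fun z => hB _)
  -- Only the test function is translated and differentiated, so `f` need only be integrable and is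
  -- never evaluated outside the domain.
  have hder : ∀ r : ℝ, HasDerivAt (fun r : ℝ => ∫ z, f z * Ψ (z - r • v) ∂m)
      (∫ z, f z * -(fderiv ℝ Ψ (z - r • v) v) ∂m) r := by
    intro r
    refine (hasDerivAt_integral_of_dominated_loc_of_deriv_le (s := univ) (x₀ := r)
      (F := fun r z => f z * Ψ (z - r • v)) (F' := fun r z => f z * -(fderiv ℝ Ψ (z - r • v) v))
      (bound := fun z => |f z| * (D * ‖v‖))
      univ_mem (Eventually.of_forall fun r => (hint r).1) (hint r) ?_ ?_ ?_ ?_).2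
    · refine hf.1.mul (Continuous.aestronglyMeasurable ?_)
      exact ((hdc.comp (by fun_prop)).clm_apply continuous_const).neg
    · refine Eventually.of_forall fun z r _ => ?_
      rw [norm_mul, norm_neg]
      refine mul_le_mul_of_nonneg_left ?_ (norm_nonneg _)
      exact (ContinuousLinearMap.le_opNorm _ _).trans
        (mul_le_mul_of_nonneg_right (hD _) (norm_nonneg _))
    · exact hf.abs.mul_const _
    · refine Eventually.of_forall fun z r _ => ?_
      have h1 : HasDerivAt (fun r : ℝ => z - r • v) (-v) r := by
        simpa using ((hasDerivAt_id r).smul_const v).const_sub z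
      have h2 := ((hΨ.differentiable (by simp)) (z - r • v)).hasFDerivAt.comp_hasDerivAt r h1
      simpa using h2.const_mul (f z)
  have := norm_image_sub_le_of_norm_deriv_le_segment_01' (C := C)
    (fun r _ => (hder r).hasDerivWithinAt) (fun r hr => by
      rw [Real.norm_eq_abs]
      simp only [mul_neg, integral_neg, abs_neg]
      exact hC r ⟨hr.1, hr.2.le⟩)
  rw [Real.norm_eq_abs] at this
  simp only [one_smul, zero_smul, sub_zero] at this
  rw [← integral_sub (by simpa using hint 1) (by simpa using hint 0)] at this
  simpa [mul_sub] using this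

/-- Sequential Banach-Alaoglu theorem, for pointwise convergence of functionals. -/
theorem exists_subseq_tendsto_of_norm_le {E : Type*} [NormedAddCommGroup E] [NormedSpace ℝ E]
    [TopologicalSpace.SeparableSpace E] (ℓ : ℕ → StrongDual ℝ E) {M : ℝ} (hM : ∀ n, ‖ℓ n‖ ≤ M) :
    ∃ φ : ℕ → ℕ, StrictMono φ ∧ ∃ L : E → ℝ, ∀ g, Tendsto (fun n => ℓ (φ n) g) atTop (𝓝 (L g)) := by
  obtain ⟨L, -, φ, hφ, hL⟩ := WeakDual.isSeqCompact_closedBall ℝ E 0 M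
    (x := fun n => StrongDual.toWeakDual (ℓ n)) (fun n => by simpa using hM n)
  exact ⟨φ, hφ, L, fun g => (WeakDual.eval_continuous g).continuousAt.tendsto.comp hL⟩

/-- A bounded sequence in `L¹` of a compact set has a subsequence whose pairings with all continuous
functions converge. -/
theorem exists_subseq_tendsto_integral_mul {Z : Type*} [MetricSpace Z] [MeasurableSpace Z]
    [BorelSpace Z] {m : Measure Z} {X : Set Z} (hX : IsCompact X) (hm : ∀ᵐ z ∂m, z ∈ X)
    {f : ℕ → Z → ℝ} (hf : ∀ n, Integrable (f n) m) {M : ℝ} (hM : ∀ n, ∫ z, |f n z| ∂m ≤ M) :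
    ∃ φ : ℕ → ℕ, StrictMono φ ∧ ∀ k : Z → ℝ, Continuous k →
      ∃ l, Tendsto (fun n => ∫ z, f (φ n) z * k z ∂m) atTop (𝓝 l) := by
  have := isCompact_iff_compactSpace.1 hX
  have hXm : MeasurableSet X := hX.measurableSet
  set m' : Measure X := m.comap (↑) with hm'
  have hmX : m.restrict X = m := Measure.restrict_eq_self_of_ae_mem hm
  have hint : ∀ F : Z → ℝ, ∫ x : X, F x ∂m' = ∫ z, F z ∂m := fun F => by
    rw [hm', integral_subtype_comap hXm, hmX]
  have hf' : ∀ n, Integrable (fun x : X => f n x) m' := fun n => by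
    have h := hf n
    rw [← hmX] at h
    exact (integrableOn_iff_comap_subtypeVal hXm).1 h
  have hi : ∀ n (g : C(X, ℝ)), Integrable (fun x : X => f n x * g x) m' := fun n g =>
    (hf' n).mul_bdd (c := ‖g‖) g.continuous.aestronglyMeasurable
      (Eventually.of_forall fun x => g.norm_coe_le_norm x)
  -- Passing to `C(X, ℝ)` with `X` compact metric provides the separable space needed for sequential
  -- weak-* compactness.
  let ℓ : ℕ → StrongDual ℝ C(X, ℝ) := fun n => LinearMap.mkContinuous
    { toFun := fun g => ∫ x : X, f n x * g x ∂m'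
      map_add' := fun g h => by
        simp only [ContinuousMap.add_apply, mul_add]
        exact integral_add (hi n g) (hi n h)
      map_smul' := fun a g => by
        simp only [ContinuousMap.smul_apply, smul_eq_mul, RingHom.id_apply]
        rw [← integral_const_mul]
        congr 1; ext x; ring } M (fun g => by
      refine (norm_integral_le_of_norm_le ((hf' n).abs.mul_const ‖g‖)
        (Eventually.of_forall fun x => ?_)).trans ?_
      · rw [norm_mul]
        exact mul_le_mul_of_nonneg_left (g.norm_coe_le_norm x) (norm_nonneg _)
      · rw [integral_mul_const, hint (fun z => |f n z|)]
        exact mul_le_mul_of_nonneg_right (hM n) (norm_nonneg _))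
  have hM0 : 0 ≤ M := (integral_nonneg fun _ => abs_nonneg _).trans (hM 0)
  obtain ⟨φ, hφ, L, hL⟩ := exists_subseq_tendsto_of_norm_le ℓ
    (fun n => LinearMap.mkContinuous_norm_le _ hM0 _)
  refine ⟨φ, hφ, fun k hk => ?_⟩
  let g : C(X, ℝ) := ⟨fun x => k x, hk.comp continuous_subtype_val⟩
  refine ⟨L g, (hL g).congr fun n => ?_⟩
  exact hint fun z => f (φ n) z * k z

end FastReaction

/-! ### Mollification of test functions in space and in time. -/

namespace FastReaction

/-- If `f` nearly annihilates the differences between `Ψ` and its translates along `ι`, it nearly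
annihilates the difference between `Ψ` and its mollification along `ι`. -/
theorem abs_integral_mul_mollify_sub_le {Z F : Type*} [NormedAddCommGroup Z] [NormedSpace ℝ Z]
    [MeasurableSpace Z] [BorelSpace Z] [SecondCountableTopology Z]
    [NormedAddCommGroup F] [NormedSpace ℝ F] [FiniteDimensional ℝ F] [MeasurableSpace F]
    [BorelSpace F] (ν : Measure F) [ν.IsAddHaarMeasure] (ψ : ContDiffBump (0 : F))
    (ι : F →L[ℝ] Z) {m : Measure Z} [SFinite m] {f : Z → ℝ} (hf : Integrable f m) {Ψ : Z → ℝ}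
    (hΨ : Continuous Ψ) (hΨ1 : ∀ z, |Ψ z| ≤ 1) {C : ℝ}
    (hC : ∀ y, ‖y‖ ≤ ψ.rOut → |∫ z, f z * (Ψ (z - ι y) - Ψ z) ∂m| ≤ C) :
    |∫ z, f z * ((∫ y, ψ.normed ν y * Ψ (z - ι y) ∂ν) - Ψ z) ∂m| ≤ C := by
  have h := abs_integral_mul_average_le (m := m) (ν := ν) hf (ψ.integrable_normed (μ := ν))
    ψ.nonneg_normed ψ.integral_normed (H := fun z y => Ψ (z - ι y) - Ψ z) (B := 2) (C := C)
    (Continuous.measurable (by unfold Function.uncurry; fun_prop))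
    (fun z p => by
      have h1 := abs_le.1 (hΨ1 (z - ι p)); have h2 := abs_le.1 (hΨ1 z)
      exact abs_le.2 ⟨by linarith, by linarith⟩)
    (fun p hp => hC p <| by
      have : p ∈ Function.support (ψ.normed ν) := hp
      rw [ψ.support_normed_eq, mem_ball_zero_iff] at this
      exact this.le)
  convert h using 5 with z
  have hi : Integrable (fun y => ψ.normed ν y * Ψ (z - ι y)) ν :=
    (ψ.integrable_normed (μ := ν)).mul_bdd (c := 1)
      (hΨ.comp (by fun_prop)).aestronglyMeasurable (Eventually.of_forall fun y => hΨ1 _)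
  simp_rw [mul_sub]
  rw [integral_sub hi ((ψ.integrable_normed (μ := ν)).mul_const _), integral_mul_const,
    ψ.integral_normed, one_mul]

/-- Mollification in the space variable. -/
noncomputable def spaceMollify {d : ℕ} (ψ : ContDiffBump (0 : Space d)) (Ψ : ℝ × Space d → ℝ)
    (z : ℝ × Space d) : ℝ :=
  ∫ y, ψ.normed volume y * Ψ (z - ContinuousLinearMap.inr ℝ ℝ (Space d) y)

section spaceMollify

variable {d : ℕ} (ψ : ContDiffBump (0 : Space d)) {Ψ : ℝ × Space d → ℝ}

theorem abs_spaceMollify_le (hΨ1 : ∀ z, |Ψ z| ≤ 1) (z : ℝ × Space d) :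
    |spaceMollify ψ Ψ z| ≤ 1 := by
  rw [← Real.norm_eq_abs]
  refine (norm_integral_le_of_norm_le (ψ.integrable_normed (μ := volume))
    (Eventually.of_forall fun t => ?_)).trans_eq ψ.integral_normed
  rw [norm_mul, Real.norm_of_nonneg (ψ.nonneg_normed _)]
  exact mul_le_of_le_one_right (ψ.nonneg_normed _) (hΨ1 _)

theorem tsupport_spaceMollify_subset :
    tsupport (spaceMollify ψ Ψ) ⊆ Metric.cthickening ψ.rOut (tsupport Ψ) := by
  refine closure_minimal (fun z hz => ?_) Metric.isClosed_cthickening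
  by_contra hcon
  refine hz (integral_eq_zero_of_ae (Eventually.of_forall fun y => ?_))
  simp only [Pi.zero_apply, mul_eq_zero]
  by_contra! hne
  have hy : y ∈ Function.support (ψ.normed volume) := hne.1
  rw [ψ.support_normed_eq, mem_ball_zero_iff] at hy
  refine hcon (Metric.mem_cthickening_of_dist_le _ _ _ _ (subset_tsupport _ hne.2) ?_)
  simpa [dist_eq_norm, Prod.norm_def] using hy.le

theorem contDiff_spaceMollify (hΨ : ContDiff ℝ ∞ Ψ) (hc : HasCompactSupport Ψ) :
    ContDiff ℝ ∞ (spaceMollify ψ Ψ) := by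
  have h := contDiffOn_convolution_right_with_param (𝕜 := ℝ) (n := ⊤) (μ := volume)
    (ContinuousLinearMap.lsmul ℝ ℝ) (f := ψ.normed volume)
    (g := fun (t : ℝ) (x : Space d) => Ψ (t, x)) isOpen_univ (hc.isCompact.image continuous_snd)
    (fun t x _ hx => by
      by_contra hne
      exact hx ⟨(t, x), subset_tsupport _ hne, rfl⟩)
    (ψ.integrable_normed (μ := volume)).locallyIntegrable hΨ.contDiffOn
  rw [univ_prod_univ, contDiffOn_univ] at h
  convert h using 1
  ext z
  simp only [spaceMollify, convolution_def, ContinuousLinearMap.lsmul_apply, smul_eq_mul]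
  congr 1; ext y
  congr 2
  ext <;> simp

/-- A change of variables puts the `x`-dependence entirely on the kernel, so the Lipschitz constant
of the kernel times the volume of `Y` bounds the spatial derivative. The essential point is that `L`
is chosen before `Ψ`: the criterion applies this to sign approximations that vary with the indices.
-/
theorem exists_abs_fderiv_spaceMollify_le {Y : Set (Space d)} (hY : IsCompact Y) :
    ∃ L : ℝ, 0 ≤ L ∧ ∀ Ψ : ℝ × Space d → ℝ, ContDiff ℝ ∞ Ψ → HasCompactSupport Ψ →
      (∀ z, |Ψ z| ≤ 1) → tsupport Ψ ⊆ univ ×ˢ Y →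
      ∀ z v, |fderiv ℝ (spaceMollify ψ Ψ) z (0, v)| ≤ L * ‖v‖ := by
  obtain ⟨A, hA⟩ := (ψ.hasCompactSupport_normed (μ := volume)).fderiv (𝕜 := ℝ)
    |>.exists_bound_of_continuous ((ψ.contDiff_normed (n := 1)).continuous_fderiv (by simp))
  have hA0 : 0 ≤ A := (norm_nonneg _).trans (hA 0)
  have hlip : ∀ a b, |ψ.normed volume a - ψ.normed volume b| ≤ A * ‖a - b‖ := fun a b =>
    Convex.norm_image_sub_le_of_norm_fderiv_le (𝕜 := ℝ) (s := univ)
      (fun x _ => (ψ.contDiff_normed (n := 1)).differentiable (by simp) x) (fun x _ => hA x)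
      convex_univ (mem_univ _) (mem_univ _)
  refine ⟨A * volume.real Y, by positivity, fun Ψ hΨ hc hΨ1 hΨY z v => ?_⟩
  have hrep : ∀ x, spaceMollify ψ Ψ (z.1, x) = ∫ y in Y, ψ.normed volume (x - y) * Ψ (z.1, y) := by
    intro x
    rw [setIntegral_eq_integral_of_forall_compl_eq_zero, ← integral_sub_left_eq_self _ volume x]
    · simp only [spaceMollify, sub_sub_cancel]
      congr 1; ext y
      congr 2
      ext <;> simp
    · intro y hy
      have : Ψ (z.1, y) = 0 := by
        by_contra hne
        exact hy (hΨY (subset_tsupport _ hne)).2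
      rw [this, mul_zero]
  have hint : ∀ x, IntegrableOn (fun y => ψ.normed volume (x - y) * Ψ (z.1, y)) Y := fun x =>
    (ContinuousOn.integrableOn_compact hY (Continuous.continuousOn
      ((ψ.continuous_normed.comp (by fun_prop)).mul (hΨ.continuous.comp (by fun_prop)))))
  have hder := ((contDiff_spaceMollify ψ hΨ hc).differentiable (by simp) z).hasFDerivAt
  have hcomp : HasFDerivAt (fun x => spaceMollify ψ Ψ (z.1, x))
      ((fderiv ℝ (spaceMollify ψ Ψ) z).comp (ContinuousLinearMap.inr ℝ ℝ (Space d))) z.2 :=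
    HasFDerivAt.comp z.2 (g := spaceMollify ψ Ψ) (f := fun x => (z.1, x)) hder
      (hasFDerivAt_prodMk_right z.1 z.2)
  have hle := hcomp.le_of_lip' (C := A * volume.real Y) (by positivity)
    (Eventually.of_forall fun x => by
      rw [hrep, hrep, ← integral_sub (hint x) (hint z.2)]
      refine (norm_setIntegral_le_of_norm_le_const (C := A * ‖x - z.2‖) hY.measure_lt_top
        fun y _ => ?_).trans_eq (by ring)
      rw [← sub_mul, norm_mul]
      refine (mul_le_of_le_one_right (norm_nonneg _) (hΨ1 _)).trans ?_
      simpa using hlip (x - y) (z.2 - y))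
  simpa using (ContinuousLinearMap.le_opNorm _ v).trans
    (mul_le_mul_of_nonneg_right hle (norm_nonneg v))

/-- Mollification in space and then in time is integration against a product kernel. -/
theorem integral_normed_mul_spaceMollify (η : ContDiffBump (0 : ℝ)) (hΨ : Continuous Ψ)
    (hΨ1 : ∀ z, |Ψ z| ≤ 1) (z : ℝ × Space d) :
    ∫ s, η.normed volume s * spaceMollify ψ Ψ (z - ContinuousLinearMap.inl ℝ ℝ (Space d) s) =
      ∫ w : ℝ × Space d, η.normed volume (z - w).1 * ψ.normed volume (z - w).2 * Ψ w := by
  have : (volume : Measure (ℝ × Space d)).IsAddHaarMeasure := by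
    rw [Measure.volume_eq_prod]; infer_instance
  rw [← integral_sub_left_eq_self _ volume z]
  simp only [sub_sub_cancel]
  rw [Measure.volume_eq_prod, integral_prod]
  · congr 1; ext s
    rw [spaceMollify, ← integral_const_mul]
    congr 1; ext y
    rw [← mul_assoc]
    congr 2
    ext <;> simp
  · exact ((η.integrable_normed (μ := volume)).mul_prod
      (ψ.integrable_normed (μ := volume))).mul_bdd (c := 1)
      (hΨ.comp (by fun_prop)).aestronglyMeasurable (Eventually.of_forall fun y => hΨ1 _)

end spaceMollify

end FastReaction

/-! ### The compactness criterion in `L¹` of the cylinder. -/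

namespace FastReaction

theorem isFiniteMeasure_spaceTime {d : ℕ} {Ω : Set (Space d)} (hΩ : IsCompact Ω) (T : ℝ) :
    IsFiniteMeasure (spaceTime Ω T) :=
  ⟨by rw [spaceTime, Measure.restrict_apply_univ]; exact (isCompact_Icc.prod hΩ).measure_lt_top⟩

theorem ae_mem_spaceTime {d : ℕ} {Ω : Set (Space d)} (hΩ : IsCompact Ω) (T : ℝ) :
    ∀ᵐ p ∂(spaceTime Ω T), p ∈ Icc 0 T ×ˢ Ω :=
  ae_restrict_mem (isCompact_Icc.prod hΩ).measurableSet

/-- If all pairings of a bounded sequence in `L¹` with continuous functions converge, then so do the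
convolutions with a continuous kernel, in `L¹`. -/
theorem tendsto_integral_abs_kernel_sub {Z : Type*} [NormedAddCommGroup Z]
    [MeasurableSpace Z] [BorelSpace Z] [SecondCountableTopology Z] {m : Measure Z}
    [IsFiniteMeasure m] {f : ℕ → Z → ℝ} (hf : ∀ n, Integrable (f n) m) {M : ℝ}
    (hM : ∀ n, ∫ z, |f n z| ∂m ≤ M)
    (hw : ∀ k : Z → ℝ, Continuous k → ∃ l, Tendsto (fun n => ∫ z, f n z * k z ∂m) atTop (𝓝 l))
    {χ : Z → ℝ} (hχ : Continuous χ) {B : ℝ} (hB : ∀ z, |χ z| ≤ B) :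
    Tendsto (fun p : ℕ × ℕ => ∫ w, |(∫ z, f p.1 z * χ (z - w) ∂m) - ∫ z, f p.2 z * χ (z - w) ∂m| ∂m)
      atTop (𝓝 0) := by
  have hB0 : 0 ≤ B := (abs_nonneg _).trans (hB 0)
  have hmeas : ∀ n, AEStronglyMeasurable (fun w => ∫ z, f n z * χ (z - w) ∂m) m := fun n =>
    AEStronglyMeasurable.integral_prod_right' (f := fun q : Z × Z => f n q.2 * χ (q.2 - q.1))
      ((hf n).1.comp_snd.mul (hχ.comp (by fun_prop)).aestronglyMeasurable)
  have hbd : ∀ n w, |∫ z, f n z * χ (z - w) ∂m| ≤ M * B := fun n w => by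
    rw [← Real.norm_eq_abs]
    refine (norm_integral_le_of_norm_le ((hf n).abs.mul_const B)
      (Eventually.of_forall fun z => ?_)).trans ?_
    · rw [norm_mul]; exact mul_le_mul_of_nonneg_left (hB _) (norm_nonneg _)
    · rw [integral_mul_const]; exact mul_le_mul_of_nonneg_right (hM n) hB0
  -- For fixed `w` the kernel `χ (· - w)` is a continuous test function, so the convolutions
  -- converge pointwise in `w`. They are uniformly bounded and `m` is finite, so dominated
  -- convergence applies to their differences, without identifying a limit.
  rw [← prod_atTop_atTop_eq]
  have h := tendsto_integral_filter_of_dominated_convergence (μ := m)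
    (l := (atTop : Filter ℕ) ×ˢ (atTop : Filter ℕ)) (f := fun _ => (0 : ℝ))
    (F := fun p w => |(∫ z, f p.1 z * χ (z - w) ∂m) - ∫ z, f p.2 z * χ (z - w) ∂m|)
    (fun _ => 2 * (M * B))
    (Eventually.of_forall fun p => ((hmeas p.1).sub (hmeas p.2)).norm)
    (Eventually.of_forall fun p => Eventually.of_forall fun w => by
      rw [Real.norm_eq_abs, abs_abs]
      refine (abs_sub _ _).trans ?_
      linarith [hbd p.1 w, hbd p.2 w]) (integrable_const _)
    (Eventually.of_forall fun w => by
      obtain ⟨l, hl⟩ := hw (fun z => χ (z - w)) (hχ.comp (by fun_prop))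
      simpa using ((hl.comp tendsto_fst).sub (hl.comp tendsto_snd)).abs)
  simpa using h

/-- A sequence which is Cauchy for the integral distance converges. -/
theorem exists_tendsto_integral_abs_sub {Z : Type*} [MeasurableSpace Z] {m : Measure Z}
    {f : ℕ → Z → ℝ} (hf : ∀ n, Integrable (f n) m)
    (hC : ∀ κ > 0, ∃ N, ∀ n ≥ N, ∀ k ≥ N, ∫ z, |f n z - f k z| ∂m ≤ κ) :
    ∃ f₀ : Z → ℝ, Integrable f₀ m ∧ Tendsto (fun n => ∫ z, |f n z - f₀ z| ∂m) atTop (𝓝 0) := by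
  have hd : ∀ (g h : Z → ℝ) (hg : Integrable g m) (hh : Integrable h m),
      dist (hg.toL1 g) (hh.toL1 h) = ∫ z, |g z - h z| ∂m := fun g h hg hh => by
    rw [dist_eq_norm, ← Integrable.toL1_sub, L1.norm_of_fun_eq_integral_norm]
    rfl
  have hcau : CauchySeq fun n => (hf n).toL1 (f n) := by
    refine Metric.cauchySeq_iff.2 fun κ hκ => ?_
    obtain ⟨N, hN⟩ := hC (κ / 2) (half_pos hκ)
    exact ⟨N, fun n hn k hk => by rw [hd]; linarith [hN n hn k hk]⟩
  obtain ⟨g, hg⟩ := cauchySeq_tendsto_of_complete hcau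
  refine ⟨g, L1.integrable_coeFn g, ?_⟩
  rw [tendsto_iff_dist_tendsto_zero] at hg
  refine hg.congr fun n => ?_
  rw [← hd _ _ (hf n) (L1.integrable_coeFn g), Integrable.toL1_coeFn]

/-- Compactness criterion in `L¹([0,T] × Ω)`: translations in space are controlled in `L¹`,
translations in time are controlled in a dual norm, and no mass concentrates near the boundary. -/
theorem exists_subseq_tendsto_integral_abs_sub {d : ℕ} {Ω : Set (Space d)} (hΩ : IsCompact Ω)
    {T : ℝ} {O : Set (ℝ × Space d)} (hO : IsOpen O) (hOX : O ⊆ Icc 0 T ×ˢ Ω)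
    {f : ℕ → ℝ × Space d → ℝ} (hf : ∀ n, Integrable (f n) (spaceTime Ω T)) {M : ℝ}
    (hM : ∀ n, ∫ z, |f n z| ∂(spaceTime Ω T) ≤ M)
    (hS : ∀ n (Ψ : ℝ × Space d → ℝ) (v : Space d), ContDiff ℝ ∞ Ψ → HasCompactSupport Ψ →
      (∀ z, |Ψ z| ≤ 1) → Metric.cthickening ‖v‖ (tsupport Ψ) ⊆ O →
      |∫ z, f n z * (Ψ (z - (0, v)) - Ψ z) ∂(spaceTime Ω T)| ≤ M * ‖v‖)
    (hT : ∀ κ > 0, ∃ N, ∃ A : ℝ, 0 ≤ A ∧ ∀ n ≥ N, ∀ (Ψ : ℝ × Space d → ℝ) (L s : ℝ),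
      ContDiff ℝ ∞ Ψ → HasCompactSupport Ψ → (∀ z, |Ψ z| ≤ 1) → 0 ≤ L →
      (∀ z v, |fderiv ℝ Ψ z (0, v)| ≤ L * ‖v‖) → Metric.cthickening |s| (tsupport Ψ) ⊆ O →
      |∫ z, f n z * (Ψ (z - (s, 0)) - Ψ z) ∂(spaceTime Ω T)| ≤ κ + A * (1 + L) * |s|)
    (hK : ∀ κ > 0, ∃ K, IsCompact K ∧ K ⊆ O ∧ ∀ n, ∫ z in Kᶜ, |f n z| ∂(spaceTime Ω T) ≤ κ) :
    ∃ φ : ℕ → ℕ, StrictMono φ ∧ ∃ f₀ : ℝ × Space d → ℝ, Integrable f₀ (spaceTime Ω T) ∧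
      Tendsto (fun n => ∫ z, |f (φ n) z - f₀ z| ∂(spaceTime Ω T)) atTop (𝓝 0) := by
  have := isFiniteMeasure_spaceTime hΩ T
  have hhaar : (volume : Measure (ℝ × Space d)).IsAddHaarMeasure := by
    rw [Measure.volume_eq_prod]; infer_instance
  set m := spaceTime Ω T with hm
  have hM0 : 0 ≤ M := (integral_nonneg fun _ => abs_nonneg _).trans (hM 0)
  obtain ⟨φ, hφ, hw⟩ := exists_subseq_tendsto_integral_mul (isCompact_Icc.prod hΩ)
    (ae_mem_spaceTime hΩ T) hf hM
  refine ⟨φ, hφ, exists_tendsto_integral_abs_sub (fun n => hf (φ n)) fun κ₀ hκ₀ => ?_⟩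
  -- Budget: one `κ` for the choice of `Ψ`, one per index for mollifying in space, two per index for
  -- mollifying in time, one for the convolutions, one per index off `K`. This makes ten.
  obtain ⟨κ, hκ, rfl⟩ : ∃ κ > 0, κ₀ = 11 * κ := ⟨κ₀ / 11, by positivity, by ring⟩
  obtain ⟨K, hKc, hKO, hKt⟩ := hK κ hκ
  obtain ⟨r₀, hr₀, hr₀O⟩ := hKc.exists_cthickening_subset_open hO hKO
  -- Three successive enlargements of `K` must stay in `O`: the support of `Ψ`, the spatial
  -- mollification, and the time translations.
  obtain ⟨r, hr, rfl⟩ : ∃ r > 0, r₀ = r + (r + r) := ⟨r₀ / 3, by positivity, by ring⟩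
  have hcth : ∀ {a b : ℝ} {S S' : Set (ℝ × Space d)}, a ≤ b → S ⊆ S' →
      Metric.cthickening a S ⊆ Metric.cthickening b S' := fun hab hS =>
    (Metric.cthickening_subset_of_subset _ hS).trans (Metric.cthickening_mono hab _)
  set h := min r (κ / (M + 1)) with hh
  have hh0 : 0 < h := lt_min hr (by positivity)
  have hMh : M * h ≤ κ := by
    have : h ≤ κ / (M + 1) := min_le_right _ _
    calc M * h ≤ (M + 1) * (κ / (M + 1)) := by gcongr; linarith
      _ = κ := by field_simp
  let ψ : ContDiffBump (0 : Space d) := ⟨h / 2, h, by positivity, by linarith⟩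
  -- The order of choices matters: the space scale `h` fixes `L`, and only then is the time scale
  -- `τ` taken small relative to `L`.
  obtain ⟨L, hL0, hL⟩ := exists_abs_fderiv_spaceMollify_le ψ hΩ
  obtain ⟨N₁, A, hA0, hA⟩ := hT κ hκ
  set τ := min r (κ / (A * (1 + L) + 1)) with hτ
  have hτ0 : 0 < τ := lt_min hr (by positivity)
  have hAτ : A * (1 + L) * τ ≤ κ := by
    have : τ ≤ κ / (A * (1 + L) + 1) := min_le_right _ _
    calc A * (1 + L) * τ ≤ (A * (1 + L) + 1) * (κ / (A * (1 + L) + 1)) := by gcongr; linarith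
      _ = κ := by field_simp
  let η : ContDiffBump (0 : ℝ) := ⟨τ / 2, τ, by positivity, by linarith⟩
  set χ : ℝ × Space d → ℝ := fun w => η.normed volume w.1 * ψ.normed volume w.2 with hχ
  have hχc : Continuous χ :=
    (η.continuous_normed.comp continuous_fst).mul (ψ.continuous_normed.comp continuous_snd)
  obtain ⟨B₁, hB₁⟩ := (η.hasCompactSupport_normed (μ := volume)).exists_bound_of_continuous
    η.continuous_normed
  obtain ⟨B₂, hB₂⟩ := (ψ.hasCompactSupport_normed (μ := volume)).exists_bound_of_continuous
    ψ.continuous_normed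
  have hχB : ∀ w, |χ w| ≤ B₁ * B₂ := fun w => by
    rw [hχ, abs_mul]
    exact mul_le_mul (hB₁ _) (hB₂ _) (abs_nonneg _) ((norm_nonneg _).trans (hB₁ 0))
  obtain ⟨⟨N₂, N₃⟩, hN⟩ := eventually_atTop.1 ((tendsto_integral_abs_kernel_sub
    (fun n => hf (φ n)) (fun n => hM (φ n)) hw hχc hχB).eventually (ge_mem_nhds hκ))
  refine ⟨max N₁ (max N₂ N₃), fun n hn k hk => ?_⟩
  have hn1 : N₁ ≤ φ n := (le_of_max_le_left hn).trans hφ.le_apply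
  have hk1 : N₁ ≤ φ k := (le_of_max_le_left hk).trans hφ.le_apply
  have hnk := hN (n, k) ⟨(le_max_left _ _).trans (le_of_max_le_right hn),
    (le_max_right _ _).trans (le_of_max_le_right hk)⟩
  have hgi : Integrable (fun z => f (φ n) z - f (φ k) z) m := (hf _).sub (hf _)
  -- `Ψ` depends on `n` and `k`, whereas `h`, `L`, `τ`, `χ` and the thresholds do not.
  obtain ⟨Ψ, hΨ, hΨK, hΨ1, hΨint⟩ := exists_smooth_setIntegral_abs_le volume (m := m)
    Measure.restrict_le_self.absolutelyContinuous hgi hKc hr hκ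
  have hΨc : HasCompactSupport Ψ := HasCompactSupport.of_support_subset_isCompact hKc.cthickening
    ((subset_tsupport _).trans hΨK)
  have hΨX : tsupport Ψ ⊆ Icc 0 T ×ˢ Ω :=
    ((hΨK.trans (Metric.cthickening_mono (by linarith) _)).trans hr₀O).trans hOX
  set Φ := spaceMollify ψ Ψ with hΦ
  have hΦs : ContDiff ℝ ∞ Φ := contDiff_spaceMollify ψ hΨ hΨc
  have hΦ1 : ∀ z, |Φ z| ≤ 1 := abs_spaceMollify_le ψ hΨ1
  have hΦK : tsupport Φ ⊆ Metric.cthickening (r + r) K :=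
    ((tsupport_spaceMollify_subset ψ).trans (hcth (min_le_left _ _) hΨK)).trans
      (Metric.cthickening_cthickening_subset hr.le hr.le _)
  have hΦc : HasCompactSupport Φ := HasCompactSupport.of_support_subset_isCompact hKc.cthickening
    ((subset_tsupport _).trans hΦK)
  set Θ : ℝ × Space d → ℝ := fun z => ∫ s, η.normed volume s *
    Φ (z - ContinuousLinearMap.inl ℝ ℝ (Space d) s) with hΘ
  have hΘrep : ∀ z, Θ z = ∫ w, χ (z - w) * Ψ w ∂m := fun z => by
    rw [hΘ, hm, spaceTime, setIntegral_eq_integral_of_forall_compl_eq_zero]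
    · exact integral_normed_mul_spaceMollify ψ η hΨ.continuous hΨ1 z
    · intro w hw
      have : Ψ w = 0 := by
        by_contra hne
        exact hw (hΨX (subset_tsupport _ hne))
      rw [this, mul_zero]
  have hspace : ∀ j, |∫ z, f j z * (Φ z - Ψ z) ∂m| ≤ κ := fun j => by
    refine abs_integral_mul_mollify_sub_le volume ψ (ContinuousLinearMap.inr ℝ ℝ (Space d))
      (hf j) hΨ.continuous hΨ1 fun y hy => ?_
    refine (hS j Ψ y hΨ hΨc hΨ1 ?_).trans ((mul_le_mul_of_nonneg_left hy hM0).trans hMh)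
    refine ((hcth (hy.trans (min_le_left _ _)) hΨK).trans
      (Metric.cthickening_cthickening_subset hr.le hr.le _)).trans
      ((Metric.cthickening_mono (by linarith) _).trans hr₀O)
  -- The time estimate is applied to `Φ`, not `Ψ`, because it needs a spatial Lipschitz bound that
  -- is uniform in the indices.
  have htime : ∀ j ≥ N₁, |∫ z, f j z * (Θ z - Φ z) ∂m| ≤ 2 * κ := fun j hj => by
    refine abs_integral_mul_mollify_sub_le volume η (ContinuousLinearMap.inl ℝ ℝ (Space d))
      (hf j) hΦs.continuous hΦ1 fun y hy => ?_
    refine (hA j hj Φ L y hΦs hΦc hΦ1 hL0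
      (hL Ψ hΨ hΨc hΨ1 (hΨX.trans (prod_mono_left (subset_univ _)))) ?_).trans ?_
    · exact ((hcth (hy.trans (min_le_left _ _)) hΦK).trans
        (Metric.cthickening_cthickening_subset hr.le (by linarith) _)).trans hr₀O
    · have : A * (1 + L) * |y| ≤ A * (1 + L) * τ := by
        have : |y| ≤ τ := hy
        gcongr
      linarith
  -- Fubini transfers the kernel from the test function to `f j`; afterwards only `|Ψ| ≤ 1` is
  -- needed.
  have hswap : ∀ j, Integrable (fun z => f j z * Θ z) m ∧
      ∫ z, f j z * Θ z ∂m = ∫ w, Ψ w * ∫ z, f j z * χ (z - w) ∂m ∂m := fun j => by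
    have hint : Integrable (Function.uncurry fun z w => f j z * (χ (z - w) * Ψ w))
        (m.prod m) := by
      refine ((hf j).comp_fst m).mul_bdd (c := B₁ * B₂) (Continuous.aestronglyMeasurable ?_)
        (Eventually.of_forall fun q => ?_)
      · exact (hχc.comp (by fun_prop)).mul (hΨ.continuous.comp continuous_snd)
      · rw [norm_mul]
        exact (mul_le_of_le_one_right (norm_nonneg _) (hΨ1 _)).trans (hχB _)
    simp_rw [hΘrep, ← integral_const_mul]
    refine ⟨hint.integral_prod_left, ?_⟩
    rw [integral_integral_swap hint]
    refine integral_congr_ae (Eventually.of_forall fun w => ?_)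
    refine integral_congr_ae (Eventually.of_forall fun z => ?_)
    simp only; ring
  have hbi : ∀ (j : ℕ) {G : ℝ × Space d → ℝ}, Continuous G → (∀ z, |G z| ≤ 1) →
      Integrable (fun z => f j z * G z) m := fun j G hG hG1 =>
    (hf j).mul_bdd (c := 1) hG.aestronglyMeasurable (Eventually.of_forall hG1)
  have hdec : ∀ j, ∫ z, f j z * Ψ z ∂m = ∫ z, f j z * Θ z ∂m -
      ∫ z, f j z * (Θ z - Φ z) ∂m - ∫ z, f j z * (Φ z - Ψ z) ∂m := fun j => by
    simp only [mul_sub]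
    rw [integral_sub (hswap j).1 (hbi j hΦs.continuous hΦ1),
      integral_sub (hbi j hΦs.continuous hΦ1) (hbi j hΨ.continuous hΨ1)]
    ring
  have hFmeas : ∀ j, Integrable (fun w => ∫ z, f j z * χ (z - w) ∂m) m := fun j => by
    refine Integrable.of_bound (C := M * (B₁ * B₂))
      (AEStronglyMeasurable.integral_prod_right'
        (f := fun q : (ℝ × Space d) × (ℝ × Space d) => f j q.2 * χ (q.2 - q.1))
        ((hf j).1.comp_snd.mul (hχc.comp (by fun_prop)).aestronglyMeasurable))
      (Eventually.of_forall fun w => ?_)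
    refine (norm_integral_le_of_norm_le ((hf j).abs.mul_const (B₁ * B₂))
      (Eventually.of_forall fun z => ?_)).trans ?_
    · rw [norm_mul]; exact mul_le_mul_of_nonneg_left (hχB _) (norm_nonneg _)
    · rw [integral_mul_const]
      exact mul_le_mul_of_nonneg_right (hM j) ((abs_nonneg _).trans (hχB 0))
  have hΘle : ∫ z, f (φ n) z * Θ z ∂m - ∫ z, f (φ k) z * Θ z ∂m ≤ κ := by
    have hΨF : ∀ j, Integrable (fun w => Ψ w * ∫ z, f j z * χ (z - w) ∂m) m := fun j =>
      (hFmeas j).bdd_mul (c := 1) hΨ.continuous.aestronglyMeasurable (Eventually.of_forall hΨ1)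
    rw [(hswap _).2, (hswap _).2, ← integral_sub (hΨF _) (hΨF _)]
    refine le_trans (integral_mono ((hΨF _).sub (hΨF _)) ((hFmeas _).sub (hFmeas _)).abs
      fun w => ?_) hnk
    simp only [Pi.sub_apply]
    rw [← mul_sub]
    refine (le_abs_self _).trans ?_
    rw [abs_mul]
    exact mul_le_of_le_one_left (abs_nonneg _) (hΨ1 w)
  have hin : ∫ z in K, |f (φ n) z - f (φ k) z| ∂m ≤ 8 * κ := by
    have hsub : ∫ z, (f (φ n) z - f (φ k) z) * Ψ z ∂m =
        ∫ z, f (φ n) z * Ψ z ∂m - ∫ z, f (φ k) z * Ψ z ∂m := by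
      simp only [sub_mul]
      exact integral_sub (hbi _ hΨ.continuous hΨ1) (hbi _ hΨ.continuous hΨ1)
    rw [hsub, hdec, hdec] at hΨint
    have h1 := abs_le.1 (hspace (φ n)); have h2 := abs_le.1 (hspace (φ k))
    have h3 := abs_le.1 (htime _ hn1); have h4 := abs_le.1 (htime _ hk1)
    linarith [h1.1, h2.2, h3.1, h4.2]
  have hout : ∫ z in Kᶜ, |f (φ n) z - f (φ k) z| ∂m ≤ 2 * κ := by
    refine (integral_mono (hgi.abs.integrableOn)
      (((hf (φ n)).abs.add (hf (φ k)).abs).integrableOn) fun z => abs_sub _ _).trans ?_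
    simp only [Pi.add_apply]
    rw [integral_add (hf (φ n)).abs.integrableOn (hf (φ k)).abs.integrableOn]
    linarith [hKt (φ n), hKt (φ k)]
  rw [← integral_add_compl hKc.measurableSet hgi.abs]
  linarith

end FastReaction

/-! ### Translation estimates from the weak gradient and the continuity equation. -/

namespace FastReaction

theorem tsupport_translate_subset {Z : Type*} [NormedAddCommGroup Z] {Ψ : Z → ℝ} {w : Z} {r : ℝ}
    (hw : ‖w‖ ≤ r) : tsupport (fun z => Ψ (z - w)) ⊆ Metric.cthickening r (tsupport Ψ) := by
  refine closure_minimal (fun z hz => ?_) Metric.isClosed_cthickening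
  exact Metric.mem_cthickening_of_dist_le _ _ _ _ (subset_tsupport _ hz) (by simpa [dist_eq_norm])

theorem hasCompactSupport_translate {Z : Type*} [NormedAddCommGroup Z] {Ψ : Z → ℝ} {w : Z}
    (hc : HasCompactSupport Ψ) : HasCompactSupport (fun z => Ψ (z - w)) := by
  simpa [sub_eq_add_neg, Function.comp_def] using hc.comp_homeomorph (Homeomorph.addRight (-w))

variable {d : ℕ} {Ω : Set (Space d)} {T : ℝ}

/-- A weak gradient in `L¹` controls translations in space. -/
theorem IsWeakGradient.abs_integral_translate_sub_le {ρ : ℝ × Space d → ℝ}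
    {G : ℝ × Space d → Space d} (hG : IsWeakGradient Ω T ρ G)
    (hρ : Integrable ρ (spaceTime Ω T)) {Ψ : ℝ × Space d → ℝ} {v : Space d} (hΨ : ContDiff ℝ ∞ Ψ)
    (hc : HasCompactSupport Ψ) (hΨ1 : ∀ z, |Ψ z| ≤ 1)
    (hO : Metric.cthickening ‖v‖ (tsupport Ψ) ⊆ Ioo 0 T ×ˢ interior Ω) :
    |∫ z, ρ z * (Ψ (z - (0, v)) - Ψ z) ∂(spaceTime Ω T)| ≤
      (∫ z, ‖G z‖ ∂(spaceTime Ω T)) * ‖v‖ := by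
  refine abs_integral_mul_translate_sub_le hρ hΨ hc (0, v) fun r hr => ?_
  have hnorm : ‖r • ((0 : ℝ), v)‖ ≤ ‖v‖ := by
    rw [norm_smul, Real.norm_of_nonneg hr.1]
    simpa [Prod.norm_def] using mul_le_of_le_one_left (norm_nonneg v) hr.2
  set w := r • ((0 : ℝ), v) with hw
  set φ : ℝ × Space d → ℝ := fun z => Ψ (z - w) with hφ
  have hφs : ContDiff ℝ ∞ φ := hΨ.comp (contDiff_id.sub contDiff_const)
  have hφc : HasCompactSupport φ := hasCompactSupport_translate hc
  have hfd : ∀ z, fderiv ℝ φ z = fderiv ℝ Ψ (z - w) := fun z => by rw [hφ, fderiv_comp_sub]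
  have h := hG.2 φ hφs hφc ((tsupport_translate_subset hnorm).trans hO) v
  simp only [hfd] at h
  rw [h, abs_neg, ← Real.norm_eq_abs]
  refine (norm_integral_le_of_norm_le (hG.1.norm.mul_const ‖v‖)
    (Eventually.of_forall fun z => ?_)).trans_eq (integral_mul_const _ _)
  rw [norm_mul]
  exact (mul_le_of_le_one_right (norm_nonneg _) (hΨ1 _)).trans (norm_inner_le_norm _ _)

/-- The continuity equation controls translations in time of the total density. -/
theorem GCE.abs_integral_translate_sub_le {c : Fin 2 → ℝ × Space d → ℝ}
    {J : Fin 2 → ℝ × Space d → Space d} {b : Fin 2 → ℝ × Space d → ℝ} (h : GCE Ω T c J b)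
    (hci : ∀ j, Integrable (c j) (spaceTime Ω T)) {Ψ : ℝ × Space d → ℝ} {s L : ℝ}
    (hΨ : ContDiff ℝ ∞ Ψ) (hc : HasCompactSupport Ψ)
    (hL : ∀ z v, |fderiv ℝ Ψ z (0, v)| ≤ L * ‖v‖)
    (hO : Metric.cthickening |s| (tsupport Ψ) ⊆ Ioo 0 T ×ˢ univ) :
    |∫ z, (c 0 z + c 1 z) * (Ψ (z - (s, 0)) - Ψ z) ∂(spaceTime Ω T)| ≤
      (∑ j, ∫ z, ‖J j z‖ ∂(spaceTime Ω T)) * L * |s| := by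
  refine abs_integral_mul_translate_sub_le (f := fun z => c 0 z + c 1 z)
    ((hci 0).add (hci 1)) hΨ hc (s, 0) fun r hr => ?_
  have hnorm : ‖r • (s, (0 : Space d))‖ ≤ |s| := by
    rw [norm_smul, Real.norm_of_nonneg hr.1]
    simpa [Prod.norm_def] using mul_le_of_le_one_left (abs_nonneg s) hr.2
  set w := r • (s, (0 : Space d)) with hw
  set φ : ℝ × Space d → ℝ := fun z => Ψ (z - w) with hφ
  have hφs : ContDiff ℝ ∞ φ := hΨ.comp (contDiff_id.sub contDiff_const)
  have hφc : HasCompactSupport φ := hasCompactSupport_translate hc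
  have hfd : ∀ z, fderiv ℝ φ z = fderiv ℝ Ψ (z - w) := fun z => by rw [hφ, fderiv_comp_sub]
  have hdc : Continuous (fderiv ℝ φ) := hφs.continuous_fderiv (by simp)
  obtain ⟨D, hD⟩ := (hφc.fderiv (𝕜 := ℝ)).exists_bound_of_continuous hdc
  obtain ⟨B, hB⟩ := hφc.exists_bound_of_continuous hφs.continuous
  have hti : ∀ j, Integrable (fun p => fderiv ℝ φ p (1, 0) * c j p) (spaceTime Ω T) := fun j =>
    (hci j).bdd_mul (c := D * ‖((1 : ℝ), (0 : Space d))‖)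
      (hdc.clm_apply continuous_const).aestronglyMeasurable
      (Eventually.of_forall fun z => (ContinuousLinearMap.le_opNorm _ _).trans
        (mul_le_mul_of_nonneg_right (hD z) (norm_nonneg _)))
  have hJle : ∀ j p, ‖fderiv ℝ φ p (0, J j p)‖ ≤ ‖J j p‖ * L := fun j p => by
    rw [hfd, mul_comm]; exact hL _ _
  have hJi : ∀ j, Integrable (fun p => fderiv ℝ φ p (0, J j p)) (spaceTime Ω T) := fun j =>
    ((h.1 j).norm.mul_const L).mono' (by
      have h1 : AEStronglyMeasurable (fun p => ((0 : ℝ), J j p)) (spaceTime Ω T) :=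
        aestronglyMeasurable_const.prodMk (h.1 j).1
      exact isBoundedBilinearMap_apply.continuous.comp_aestronglyMeasurable
        (hdc.aestronglyMeasurable.prodMk h1)) (Eventually.of_forall (hJle j))
  have hbi : ∀ j, Integrable (fun p => b j p * φ p) (spaceTime Ω T) := fun j =>
    (h.2.1 j).mul_bdd hφs.continuous.aestronglyMeasurable (Eventually.of_forall hB)
  have heq : ∀ j, ∫ p, fderiv ℝ φ p (1, 0) * c j p ∂(spaceTime Ω T) =
      -∫ p, fderiv ℝ φ p (0, J j p) ∂(spaceTime Ω T) - ∫ p, b j p * φ p ∂(spaceTime Ω T) :=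
    fun j => by
      have := h.2.2.2 j φ hφs hφc ((tsupport_translate_subset hnorm).trans hO)
      rw [integral_add (hti j) (hJi j)] at this
      linarith
  -- This cancellation is why the total density is used: no bound on the size of the reaction fluxes
  -- enters the final constant.
  have hb0 : ∫ p, b 0 p * φ p ∂(spaceTime Ω T) + ∫ p, b 1 p * φ p ∂(spaceTime Ω T) = 0 := by
    rw [← integral_add (hbi 0) (hbi 1)]
    refine integral_eq_zero_of_ae ?_
    filter_upwards [h.2.2.1] with p hp
    rw [← add_mul, hp, zero_mul, Pi.zero_apply]
  have hsum : ∫ z, (c 0 z + c 1 z) * fderiv ℝ Ψ (z - w) (s, 0) ∂(spaceTime Ω T) =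
      s * (-∫ p, fderiv ℝ φ p (0, J 0 p) ∂(spaceTime Ω T) -
        ∫ p, fderiv ℝ φ p (0, J 1 p) ∂(spaceTime Ω T)) := by
    have : ∫ z, (c 0 z + c 1 z) * fderiv ℝ Ψ (z - w) (s, 0) ∂(spaceTime Ω T) =
        s * (∫ p, fderiv ℝ φ p (1, 0) * c 0 p ∂(spaceTime Ω T) +
          ∫ p, fderiv ℝ φ p (1, 0) * c 1 p ∂(spaceTime Ω T)) := by
      rw [← integral_add (hti 0) (hti 1), ← integral_const_mul]
      refine integral_congr_ae (Eventually.of_forall fun z => ?_)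
      have hs : (s, (0 : Space d)) = s • ((1 : ℝ), (0 : Space d)) := by simp
      simp only
      rw [hs, map_smul, hfd, smul_eq_mul]; ring
    rw [this, heq, heq]
    linear_combination (-s) * hb0
  have hJb : ∀ j, |∫ p, fderiv ℝ φ p (0, J j p) ∂(spaceTime Ω T)| ≤
      (∫ z, ‖J j z‖ ∂(spaceTime Ω T)) * L := fun j => by
    rw [← Real.norm_eq_abs, ← integral_mul_const]
    exact norm_integral_le_of_norm_le ((h.1 j).norm.mul_const L) (Eventually.of_forall (hJle j))
  rw [hsum, abs_mul, mul_comm, Fin.sum_univ_two, add_mul]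
  refine mul_le_mul_of_nonneg_right ?_ (abs_nonneg s)
  have h0 := abs_le.1 (hJb 0); have h1 := abs_le.1 (hJb 1)
  exact abs_le.2 ⟨by linarith [h0.2, h1.2], by linarith [h0.1, h1.1]⟩

/-- Time translations of a function which is close to a smooth multiple `g` of the total density. -/
theorem GCE.abs_integral_translate_sub_le_of_approx {c : Fin 2 → ℝ × Space d → ℝ}
    {J : Fin 2 → ℝ × Space d → Space d} {b : Fin 2 → ℝ × Space d → ℝ} (h : GCE Ω T c J b)
    (hci : ∀ j, Integrable (c j) (spaceTime Ω T)) {f : ℝ × Space d → ℝ}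
    (hf : Integrable f (spaceTime Ω T)) {g : Space d → ℝ} (hg : ContDiff ℝ ∞ g) {B : ℝ}
    (hΩ : IsCompact Ω) (hB : ∀ x ∈ Ω, |g x| ≤ B ∧ ‖fderiv ℝ g x‖ ≤ B) {κ M : ℝ}
    (hκ : ∫ z, |f z - g z.2 * (c 0 z + c 1 z)| ∂(spaceTime Ω T) ≤ κ)
    (hM : ∑ j, ∫ z, ‖J j z‖ ∂(spaceTime Ω T) ≤ M) (hB0 : 0 ≤ B) {Ψ : ℝ × Space d → ℝ} {s L : ℝ}
    (hΨ : ContDiff ℝ ∞ Ψ) (hc : HasCompactSupport Ψ) (hΨ1 : ∀ z, |Ψ z| ≤ 1) (hL0 : 0 ≤ L)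
    (hL : ∀ z v, |fderiv ℝ Ψ z (0, v)| ≤ L * ‖v‖)
    (hO : Metric.cthickening |s| (tsupport Ψ) ⊆ Ioo 0 T ×ˢ interior Ω) :
    |∫ z, f z * (Ψ (z - (s, 0)) - Ψ z) ∂(spaceTime Ω T)| ≤ 2 * κ + M * B * (1 + L) * |s| := by
  set m := spaceTime Ω T with hm
  -- As `g` does not depend on time, it commutes with time translations and can be absorbed into the
  -- test function; the Leibniz rule gives the Lipschitz constant `B * (1 + L)`.
  set χ : ℝ × Space d → ℝ := fun z => g z.2 * Ψ z with hχ
  have hχs : ContDiff ℝ ∞ χ := (hg.comp contDiff_snd).mul hΨ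
  have hχc : HasCompactSupport χ := hc.mul_left
  have hχΨ : tsupport χ ⊆ tsupport Ψ := closure_mono (by
    intro z hz hz'
    exact hz (by simp [hχ, hz']))
  have hχL : ∀ z v, |fderiv ℝ χ z (0, v)| ≤ B * (1 + L) * ‖v‖ := fun z v => by
    have hgd : HasFDerivAt (fun z : ℝ × Space d => g z.2)
        ((fderiv ℝ g z.2).comp (ContinuousLinearMap.snd ℝ ℝ (Space d))) z :=
      (hg.differentiable (by simp) z.2).hasFDerivAt.comp z hasFDerivAt_snd
    have hd : HasFDerivAt χ _ z := hgd.mul (hΨ.differentiable (by simp) z).hasFDerivAt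
    have hd' : fderiv ℝ χ z (0, v) = g z.2 * fderiv ℝ Ψ z (0, v) + Ψ z * fderiv ℝ g z.2 v := by
      rw [hd.fderiv]; simp
    -- The bounds on `g` hold only over `Ω`; off the support of `Ψ` the derivative vanishes.
    by_cases hz : z ∈ tsupport Ψ
    · have hzΩ : z.2 ∈ Ω :=
        interior_subset (hO (Metric.self_subset_cthickening _ hz)).2
      rw [hd']
      have h1 : |g z.2 * fderiv ℝ Ψ z (0, v)| ≤ B * (L * ‖v‖) := by
        rw [abs_mul]
        exact mul_le_mul (hB _ hzΩ).1 (hL z v) (abs_nonneg _) hB0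
      have h2 : |Ψ z * fderiv ℝ g z.2 v| ≤ 1 * (B * ‖v‖) := by
        rw [abs_mul]
        refine mul_le_mul (hΨ1 z) ?_ (abs_nonneg _) zero_le_one
        exact (ContinuousLinearMap.le_opNorm _ _).trans
          (mul_le_mul_of_nonneg_right (hB _ hzΩ).2 (norm_nonneg v))
      linarith [abs_add_le (g z.2 * fderiv ℝ Ψ z (0, v)) (Ψ z * fderiv ℝ g z.2 v)]
    · rw [fderiv_of_notMem_tsupport (𝕜 := ℝ) fun hz' => hz (hχΨ hz')]
      simpa using by positivity
  have hmain := h.abs_integral_translate_sub_le hci (s := s) hχs hχc hχL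
    ((Metric.cthickening_subset_of_subset _ hχΨ).trans
      (hO.trans (prod_mono_right (subset_univ _))))
  have hui : Integrable (fun z => c 0 z + c 1 z) m := (hci 0).add (hci 1)
  have hgu : Integrable (fun z => g z.2 * (c 0 z + c 1 z)) m :=
    hui.bdd_mul (c := B) (hg.continuous.comp continuous_snd).aestronglyMeasurable (by
      filter_upwards [ae_mem_spaceTime hΩ T] with z hz using (hB _ hz.2).1)
  have hΔc : Continuous fun z => Ψ (z - (s, 0)) - Ψ z :=
    (hΨ.continuous.comp (by fun_prop)).sub hΨ.continuous
  have hΔ2 : ∀ z, |Ψ (z - (s, 0)) - Ψ z| ≤ 2 := fun z =>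
    (abs_sub _ _).trans (by linarith [hΨ1 z, hΨ1 (z - (s, 0))])
  have hbd : ∀ {F : ℝ × Space d → ℝ}, Integrable F m →
      Integrable (fun z => F z * (Ψ (z - (s, 0)) - Ψ z)) m := fun hF =>
    hF.mul_bdd hΔc.aestronglyMeasurable (Eventually.of_forall hΔ2)
  have hsplit : ∫ z, f z * (Ψ (z - (s, 0)) - Ψ z) ∂m =
      ∫ z, (f z - g z.2 * (c 0 z + c 1 z)) * (Ψ (z - (s, 0)) - Ψ z) ∂m +
        ∫ z, (c 0 z + c 1 z) * (χ (z - (s, 0)) - χ z) ∂m := by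
    have : ∀ z, (c 0 z + c 1 z) * (χ (z - (s, 0)) - χ z) =
        g z.2 * (c 0 z + c 1 z) * (Ψ (z - (s, 0)) - Ψ z) := fun z => by
      simp only [hχ, Prod.snd_sub, sub_zero]; ring
    simp_rw [this]
    rw [← integral_add (hbd (F := fun z => f z - g z.2 * (c 0 z + c 1 z)) (hf.sub hgu)) (hbd hgu)]
    refine integral_congr_ae (Eventually.of_forall fun z => ?_)
    simp only; ring
  have hfirst : |∫ z, (f z - g z.2 * (c 0 z + c 1 z)) * (Ψ (z - (s, 0)) - Ψ z) ∂m| ≤ κ * 2 := by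
    rw [← Real.norm_eq_abs]
    refine (norm_integral_le_of_norm_le ((hf.sub hgu).abs.mul_const 2)
      (Eventually.of_forall fun z => ?_)).trans ?_
    · rw [norm_mul]; exact mul_le_mul_of_nonneg_left (hΔ2 z) (norm_nonneg _)
    · rw [integral_mul_const]; exact mul_le_mul_of_nonneg_right hκ zero_le_two
  have hlast : (∑ j, ∫ z, ‖J j z‖ ∂m) * (B * (1 + L)) * |s| ≤ M * B * (1 + L) * |s| := by
    rw [mul_assoc M]
    gcongr
  rw [hsplit]
  refine (abs_add_le _ _).trans ?_
  linarith

end FastReaction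

/-! ### Ingredients of the a priori bounds. -/

namespace FastReaction

variable {d : ℕ} {Ω : Set (Space d)} {T α β : ℝ} {V : Fin 2 → Space d → ℝ}

/-! ### The stationary densities -/

theorem statVec_pos (hα : 0 < α) (hβ : 0 < β) (i : Fin 2) : 0 < statVec α β i := by
  fin_cases i <;> simp [statVec] <;> positivity

theorem statVec_le_one (hα : 0 < α) (hβ : 0 < β) (i : Fin 2) : statVec α β i ≤ 1 := by
  fin_cases i <;> simp [statVec] <;> rw [div_le_one (by positivity)] <;> linarith

theorem partitionConst_pos (hΩ : IsCompact Ω) (hvol : volume Ω = 1) (hα : 0 < α) (hβ : 0 < β)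
    (hV : ∀ i, ContinuousOn (V i) Ω) : 0 < partitionConst Ω α β V := by
  refine Finset.sum_pos (fun i _ => ?_) Finset.univ_nonempty
  have hpos : ∀ x, 0 < statVec α β i * Real.exp (-V i x) := fun x =>
    mul_pos (statVec_pos hα hβ i) (Real.exp_pos _)
  rw [integral_pos_iff_support_of_nonneg (fun x => (hpos x).le)
    ((continuousOn_const.mul (hV i).neg.rexp).integrableOn_compact hΩ)]
  have : Function.support (fun x => statVec α β i * Real.exp (-V i x)) = univ :=
    eq_univ_of_forall fun x => (hpos x).ne'
  rw [this, Measure.restrict_apply_univ, hvol]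
  exact one_pos

theorem tiltedStat_pos (hΩ : IsCompact Ω) (hvol : volume Ω = 1) (hα : 0 < α) (hβ : 0 < β)
    (hV : ∀ i, ContinuousOn (V i) Ω) (i : Fin 2) (x : Space d) : 0 < tiltedStat Ω α β V i x :=
  mul_pos (inv_pos.2 (partitionConst_pos hΩ hvol hα hβ hV))
    (mul_pos (statVec_pos hα hβ i) (Real.exp_pos _))

theorem continuousOn_tiltedStat (hV : ∀ i, ContinuousOn (V i) Ω) (i : Fin 2) :
    ContinuousOn (tiltedStat Ω α β V i) Ω :=
  continuousOn_const.mul (continuousOn_const.mul (hV i).neg.rexp)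

theorem exists_tiltedStat_bounds (hΩ : IsCompact Ω) (hvol : volume Ω = 1) (hα : 0 < α)
    (hβ : 0 < β) (hV : ∀ i, ContinuousOn (V i) Ω) :
    ∃ a b : ℝ, 0 < a ∧ ∀ i, ∀ x ∈ Ω, a ≤ tiltedStat Ω α β V i x ∧ tiltedStat Ω α β V i x ≤ b := by
  have hne : Ω.Nonempty := by
    rw [nonempty_iff_ne_empty]; rintro rfl; simp at hvol
  have h : ∀ i, ∃ a b : ℝ, 0 < a ∧ ∀ x ∈ Ω, a ≤ tiltedStat Ω α β V i x ∧
      tiltedStat Ω α β V i x ≤ b := fun i => by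
    obtain ⟨y, -, hy⟩ := hΩ.exists_isMinOn hne (continuousOn_tiltedStat (α := α) (β := β) hV i)
    obtain ⟨z, -, hz⟩ := hΩ.exists_isMaxOn hne (continuousOn_tiltedStat (α := α) (β := β) hV i)
    exact ⟨_, _, tiltedStat_pos hΩ hvol hα hβ hV i y, fun x hx => ⟨hy hx, hz hx⟩⟩
  choose a b ha hab using h
  refine ⟨min (a 0) (a 1), max (b 0) (b 1), lt_min (ha 0) (ha 1), fun i x hx => ?_⟩
  fin_cases i
  · exact ⟨(min_le_left _ _).trans (hab 0 x hx).1, (hab 0 x hx).2.trans (le_max_left _ _)⟩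
  · exact ⟨(min_le_right _ _).trans (hab 1 x hx).1, (hab 1 x hx).2.trans (le_max_right _ _)⟩

/-! ### Pointwise inequalities -/

/-- Young's inequality `|x| ≤ |x|²/(2a) + a`. It turns a quadratic action plus a mass bound into an
`L¹` bound, for fluxes and gradients alike. -/
theorem ofReal_norm_le_perspective_quad {a : ℝ} (ha : 0 ≤ a) (x : Space d) :
    ENNReal.ofReal ‖x‖ ≤ perspective quad a x + ENNReal.ofReal a := by
  rcases ha.eq_or_lt with rfl | ha
  · by_cases hx : x = 0 <;> simp [perspective, hx]
  · rw [perspective, if_pos ha, quad, ← ENNReal.ofReal_mul ha.le,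
      ← ENNReal.ofReal_add (by positivity) ha.le]
    refine ENNReal.ofReal_le_ofReal ?_
    rw [norm_smul, Real.norm_of_nonneg (inv_nonneg.2 ha.le)]
    have h : a * ((a⁻¹ * ‖x‖) ^ 2 / 2) + a - ‖x‖ = a⁻¹ * ((‖x‖ - a) ^ 2 + a ^ 2) / 2 := by
      field_simp; ring
    have : 0 ≤ a⁻¹ * ((‖x‖ - a) ^ 2 + a ^ 2) / 2 := by positivity
    linarith

/-- A Fenchel–Young inequality at slope `1 / κ`, obtained from `1 + y ≤ exp y` at `y = 1 / κ - log
r`. It expresses the superlinear growth behind equi-integrability. -/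
theorem le_mul_boltzmann_add {r κ : ℝ} (hr : 0 ≤ r) (hκ : 0 < κ) :
    r ≤ κ * boltzmann r + κ * Real.exp (1 / κ) := by
  rcases hr.eq_or_lt with rfl | hr
  · simp only [boltzmann, zero_mul, sub_zero, zero_add, mul_one]; positivity
  · have h := Real.add_one_le_exp (1 / κ - Real.log r)
    rw [Real.exp_sub, Real.exp_log hr, le_div_iff₀ hr] at h
    have h2 := mul_le_mul_of_nonneg_left h hκ.le
    have h3 : κ * ((1 / κ - Real.log r + 1) * r) = r - κ * (r * Real.log r) + κ * r := by
      field_simp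
    rw [boltzmann]
    linarith

/-- Factor `x - y = (√x - √y)(√x + √y)` and apply Young's inequality with weight `l`. The reactive
slope controls the square, and `l = √ε` balances the two terms. -/
theorem abs_sub_le_of_sqrt {x y l : ℝ} (hx : 0 ≤ x) (hy : 0 ≤ y) (hl : 0 < l) :
    |x - y| ≤ (Real.sqrt x - Real.sqrt y) ^ 2 / (2 * l) + l * (x + y) := by
  obtain ⟨p, hp, rfl⟩ : ∃ p, 0 ≤ p ∧ x = p ^ 2 := ⟨√x, Real.sqrt_nonneg _, (Real.sq_sqrt hx).symm⟩
  obtain ⟨q, hq, rfl⟩ : ∃ q, 0 ≤ q ∧ y = q ^ 2 := ⟨√y, Real.sqrt_nonneg _, (Real.sq_sqrt hy).symm⟩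
  rw [Real.sqrt_sq hp, Real.sqrt_sq hq]
  have key : ∀ s : ℝ, s * (p - q) * (p + q) ≤ (s * (p - q)) ^ 2 / (2 * l) + l * (p + q) ^ 2 / 2 :=
    fun s => by
      have h : (s * (p - q)) ^ 2 / (2 * l) + l * (p + q) ^ 2 / 2 - s * (p - q) * (p + q) =
          (s * (p - q) - l * (p + q)) ^ 2 / (2 * l) := by field_simp; ring
      have : 0 ≤ (s * (p - q) - l * (p + q)) ^ 2 / (2 * l) := by positivity
      linarith
  have hpq : l * (p + q) ^ 2 / 2 ≤ l * (p ^ 2 + q ^ 2) := by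
    nlinarith [mul_nonneg hl.le (sq_nonneg (p - q))]
  have h1 := key 1
  have h2 := key (-1)
  have e2 : (-1 * (p - q)) ^ 2 = (p - q) ^ 2 := by ring
  rw [one_mul] at h1
  rw [e2] at h2
  exact abs_le.2 ⟨by nlinarith, by nlinarith⟩

/-! ### Densities -/

theorem spaceTime_eq_prod (Ω : Set (Space d)) (T : ℝ) :
    spaceTime Ω T = (volume.restrict (Icc 0 T)).prod (volume.restrict Ω) := by
  rw [spaceTime, Measure.volume_eq_prod, Measure.prod_restrict]

theorem integral_abs_le_of_lintegral {Z : Type*} [MeasurableSpace Z] {m : Measure Z} {f : Z → ℝ}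
    {M : ℝ} (hM : 0 ≤ M) (hf : AEStronglyMeasurable f m) (hf0 : ∀ z, 0 ≤ f z)
    (h : ∫⁻ z, ENNReal.ofReal (f z) ∂m ≤ ENNReal.ofReal M) : ∫ z, f z ∂m ≤ M := by
  rw [integral_eq_lintegral_of_nonneg_ae (Eventually.of_forall hf0) hf]
  exact ENNReal.toReal_le_of_le_ofReal hM h

variable {μ : ℝ → Fin 2 → Measure (Space d)} {c : Fin 2 → ℝ × Space d → ℝ}

theorem IsDensity.ae_sum_lintegral_eq_one (hΩ : IsCompact Ω) (hc : IsDensity Ω T μ c)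
    (hμ : ∀ᵐ t ∂(volume.restrict (Icc 0 T)), IsState Ω (μ t)) :
    ∀ᵐ t ∂(volume.restrict (Icc 0 T)),
      ∑ i, ∫⁻ x in Ω, ENNReal.ofReal (c i (t, x)) = 1 := by
  filter_upwards [hc.2.2, hμ] with t ht hs
  rw [← hs.2]
  refine Finset.sum_congr rfl fun i _ => ?_
  rw [ht i, withDensity_apply _ hΩ.measurableSet, Measure.restrict_restrict hΩ.measurableSet,
    inter_self]

theorem IsDensity.lintegral_le (hΩ : IsCompact Ω) (hc : IsDensity Ω T μ c)
    (hμ : ∀ᵐ t ∂(volume.restrict (Icc 0 T)), IsState Ω (μ t)) (i : Fin 2) :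
    ∫⁻ p, ENNReal.ofReal (c i p) ∂(spaceTime Ω T) ≤ ENNReal.ofReal T := by
  rw [spaceTime_eq_prod, lintegral_prod _ (hc.1 i).ennreal_ofReal.aemeasurable]
  calc _ ≤ ∫⁻ _, 1 ∂(volume.restrict (Icc 0 T)) := by
        refine lintegral_mono_ae ?_
        filter_upwards [hc.ae_sum_lintegral_eq_one hΩ hμ] with t ht
        rw [← ht]
        exact Finset.single_le_sum (f := fun i => ∫⁻ x in Ω, ENNReal.ofReal (c i (t, x)))
          (fun _ _ => zero_le) (Finset.mem_univ i)
    _ = ENNReal.ofReal T := by simp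

theorem IsDensity.integrable (hΩ : IsCompact Ω) (hc : IsDensity Ω T μ c)
    (hμ : ∀ᵐ t ∂(volume.restrict (Icc 0 T)), IsState Ω (μ t)) (i : Fin 2) :
    Integrable (c i) (spaceTime Ω T) := by
  refine ⟨(hc.1 i).aestronglyMeasurable, ?_⟩
  rw [hasFiniteIntegral_iff_ofReal (Eventually.of_forall (hc.2.1 i))]
  exact (hc.lintegral_le hΩ hμ i).trans_lt ENNReal.ofReal_lt_top

theorem aestronglyMeasurable_tiltedStat (hΩ : IsCompact Ω) (hV : ∀ i, ContinuousOn (V i) Ω)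
    (i : Fin 2) :
    AEStronglyMeasurable (fun p : ℝ × Space d => tiltedStat Ω α β V i p.2) (spaceTime Ω T) :=
  ((continuousOn_tiltedStat hV i).comp continuousOn_snd fun _ hp => hp.2).aestronglyMeasurable
    (isCompact_Icc.prod hΩ).measurableSet

theorem integrable_relDensity (hΩ : IsCompact Ω) (hV : ∀ i, ContinuousOn (V i) Ω) {a b : ℝ}
    (ha : 0 < a) (hab : ∀ i, ∀ x ∈ Ω, a ≤ tiltedStat Ω α β V i x ∧ tiltedStat Ω α β V i x ≤ b)
    {i : Fin 2} (hc : Integrable (c i) (spaceTime Ω T)) :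
    Integrable (relDensity Ω α β V c i) (spaceTime Ω T) := by
  refine (hc.mul_bdd (g := fun p => (tiltedStat Ω α β V i p.2)⁻¹) (c := a⁻¹)
    (aestronglyMeasurable_tiltedStat hΩ hV i).inv₀ ?_).congr
    (Eventually.of_forall fun p => (div_eq_mul_inv _ _).symm)
  filter_upwards [ae_mem_spaceTime hΩ T] with p hp
  have h := (hab i p.2 hp.2).1
  rw [norm_inv, Real.norm_of_nonneg (ha.le.trans h)]
  exact inv_anti₀ ha h

theorem relDensity_nonneg (hΩ : IsCompact Ω) (hvol : volume Ω = 1) (hα : 0 < α) (hβ : 0 < β)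
    (hV : ∀ i, ContinuousOn (V i) Ω) (hc : ∀ i p, 0 ≤ c i p) (i : Fin 2) (p : ℝ × Space d) :
    0 ≤ relDensity Ω α β V c i p :=
  div_nonneg (hc i p) (tiltedStat_pos hΩ hvol hα hβ hV i _).le

theorem relDensity_le {a b : ℝ}
    (ha : 0 < a) (hab : ∀ i, ∀ x ∈ Ω, a ≤ tiltedStat Ω α β V i x ∧ tiltedStat Ω α β V i x ≤ b)
    (hc : ∀ i p, 0 ≤ c i p) {p : ℝ × Space d} (hp : p.2 ∈ Ω) (i : Fin 2) :
    relDensity Ω α β V c i p ≤ a⁻¹ * c i p := by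
  rw [relDensity, div_eq_inv_mul]
  exact mul_le_mul_of_nonneg_right (inv_anti₀ ha (hab i _ hp).1) (hc i p)

/-- Consequence of the energy bound. -/
theorem IsDensity.lintegral_boltzmann_le (hc : IsDensity Ω T μ c) {C : ℝ≥0}
    (hE : essSup (fun t => energy Ω α β (μ t)) (volume.restrict (Icc 0 T)) ≤ C) (i : Fin 2) :
    ∫⁻ p, ENNReal.ofReal (boltzmann (c i p / statVec α β i) * statVec α β i) ∂(spaceTime Ω T) ≤
      C * ENNReal.ofReal T := by
  have hmeas : Measurable fun p =>
      ENNReal.ofReal (boltzmann (c i p / statVec α β i) * statVec α β i) := by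
    have := hc.1 i
    unfold boltzmann
    fun_prop
  rw [spaceTime_eq_prod, lintegral_prod _ hmeas.aemeasurable]
  calc _ ≤ ∫⁻ _, (C : ℝ≥0∞) ∂(volume.restrict (Icc 0 T)) := by
        refine lintegral_mono_ae ?_
        filter_upwards [hc.2.2, ENNReal.ae_le_essSup fun t => energy Ω α β (μ t)] with t ht hEt
        refine le_trans ?_ (hEt.trans hE)
        have hmt : ∀ j, Measurable fun x => ENNReal.ofReal (c j (t, x)) := fun j =>
          ((hc.1 j).comp measurable_prodMk_left).ennreal_ofReal
        rw [energy, if_pos fun j => by rw [ht j]; exact withDensity_absolutelyContinuous _ _]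
        refine le_trans (le_of_eq ?_) (Finset.single_le_sum (f := fun j => ∫⁻ x in Ω,
          ENNReal.ofReal (boltzmann (((μ t j).rnDeriv (volume.restrict Ω) x).toReal /
            statVec α β j) * statVec α β j)) (fun _ _ => zero_le) (Finset.mem_univ i))
        refine lintegral_congr_ae ?_
        have := Measure.rnDeriv_withDensity (volume.restrict Ω) (hmt i)
        rw [← ht i] at this
        filter_upwards [this] with x hx
        rw [hx, ENNReal.toReal_ofReal (hc.2.1 i _)]
    _ = C * ENNReal.ofReal T := by simp

end FastReaction

/-! ### Uniform estimates from the dissipation and the energy. -/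

namespace FastReaction

variable {d : ℕ} {Ω : Set (Space d)} {T α β : ℝ} {V : Fin 2 → Space d → ℝ}

/-- The infima need not be attained; relaxing `C` to `C + 1` makes the inequality strict, so that a
density, fluxes and a gradient can be selected. Each nonnegative summand then inherits the bound. -/
theorem exists_lt_of_dissipation_le {δ : Fin 2 → ℝ} {ε : ℝ} {μ : ℝ → Fin 2 → Measure (Space d)}
    {C : ℝ≥0} (hD : dissipation Ω T α β δ V ε μ ≤ C) :
    ∃ (c : Fin 2 → ℝ × Space d → ℝ) (J : Fin 2 → ℝ × Space d → Space d)
      (b : Fin 2 → ℝ × Space d → ℝ) (G : ℝ × Space d → Space d),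
      IsDensity Ω T μ c ∧ GCE Ω T c J b ∧ IsWeakGradient Ω T (relDensity Ω α β V c 0) G ∧
      velocityPart Ω T δ ε c J b ≤ ENNReal.ofReal (C + 1) ∧
      ∫⁻ p, ENNReal.ofReal (δ 0 * tiltedStat Ω α β V 0 p.2) *
        perspective quad (relDensity Ω α β V c 0 p) (G p) ∂(spaceTime Ω T) ≤
          ENNReal.ofReal (C + 1) ∧
      reactiveSlope Ω T α β ε V c ≤ ENNReal.ofReal (C + 1) := by
  have hC : ENNReal.ofReal (C + 1) = (C : ℝ≥0∞) + 1 := by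
    rw [ENNReal.ofReal_add C.coe_nonneg zero_le_one, ENNReal.ofReal_coe_nnreal, ENNReal.ofReal_one]
  have h : dissipation Ω T α β δ V ε μ < ENNReal.ofReal (C + 1) :=
    hD.trans_lt (by rw [hC]; exact ENNReal.lt_add_right ENNReal.coe_ne_top one_ne_zero)
  simp only [dissipation, iInf_lt_iff] at h
  obtain ⟨-, c, hc, h⟩ := h
  have h1 := le_self_add.trans_lt h
  have h2 := le_add_self.trans_lt h
  simp only [iInf_lt_iff] at h1
  obtain ⟨J, b, hJ, h1⟩ := h1
  have h3 : diffusiveSlope Ω T α β δ V c 0 < ENNReal.ofReal (C + 1) := by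
    refine lt_of_le_of_lt ?_ (le_self_add.trans_lt h2)
    exact Finset.single_le_sum (f := fun j => diffusiveSlope Ω T α β δ V c j)
      (fun _ _ => zero_le) (Finset.mem_univ 0)
  simp only [diffusiveSlope, iInf_lt_iff] at h3
  obtain ⟨G, hG, h3⟩ := h3
  exact ⟨c, J, b, G, hc, hJ, hG, h1.le, h3.le, (le_add_self.trans_lt h2).le⟩

/-- Bounds on fluxes, gradients and distance from equilibrium, uniform in `ε`. -/
theorem exists_uniform_estimates (hΩ : IsCompact Ω) (hvol : volume Ω = 1) (hT : 0 < T)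
    (hα : 0 < α) (hβ : 0 < β) {δ : Fin 2 → ℝ} (hδ : ∀ i, 0 < δ i)
    (hV : ∀ i, ContinuousOn (V i) Ω) (C : ℝ≥0) :
    ∃ M : ℝ, 0 ≤ M ∧ ∀ (ε : ℝ) (μ : ℝ → Fin 2 → Measure (Space d)), 0 < ε →
      (∀ᵐ t ∂(volume.restrict (Icc 0 T)), IsState Ω (μ t)) →
      dissipation Ω T α β δ V ε μ ≤ C →
      ∃ (c : Fin 2 → ℝ × Space d → ℝ) (J : Fin 2 → ℝ × Space d → Space d)
        (b : Fin 2 → ℝ × Space d → ℝ) (G : ℝ × Space d → Space d),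
        IsDensity Ω T μ c ∧ GCE Ω T c J b ∧ IsWeakGradient Ω T (relDensity Ω α β V c 0) G ∧
        ∑ j, ∫ z, ‖J j z‖ ∂(spaceTime Ω T) ≤ M ∧ ∫ z, ‖G z‖ ∂(spaceTime Ω T) ≤ M ∧
        ∫ z, |relDensity Ω α β V c 0 z| ∂(spaceTime Ω T) ≤ M ∧
        ∫ z, |relDensity Ω α β V c 0 z - relDensity Ω α β V c 1 z| ∂(spaceTime Ω T) ≤
          M * Real.sqrt ε := by
  obtain ⟨a, b', ha, hab⟩ := exists_tiltedStat_bounds hΩ hvol hα hβ hV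
  -- In each constant `C + 1` comes from the dissipation and the term with `T` from the mass: `c j`
  -- integrates to at most `T`, and `ρ ≤ a⁻¹ c` on the cylinder.
  set MJ : Fin 2 → ℝ := fun j => (C + 1) + δ j * T with hMJ
  set MG : ℝ := (δ 0 * a)⁻¹ * ((C + 1) + δ 0 * a * (a⁻¹ * T)) with hMG
  set MR : ℝ := (4 * a)⁻¹ * (C + 1) + 2 * (a⁻¹ * T) with hMR
  have hJ0 : ∀ j, 0 ≤ MJ j := fun j => by have := hδ j; positivity
  have hδ0 := hδ 0
  have hG0 : 0 ≤ MG := by positivity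
  have hR0 : 0 ≤ MR := by positivity
  have ht0 : 0 ≤ a⁻¹ * T := by positivity
  refine ⟨∑ j, MJ j + MG + a⁻¹ * T + MR, by
    have := Finset.sum_nonneg fun j (_ : j ∈ Finset.univ) => hJ0 j
    positivity, fun ε μ hε hμ hD => ?_⟩
  have hsum0 := Finset.sum_nonneg fun j (_ : j ∈ Finset.univ) => hJ0 j
  obtain ⟨c, J, b, G, hc, hJ, hG, hvel, hdif, hrea⟩ := exists_lt_of_dissipation_le hD
  have hci := fun i => hc.integrable hΩ hμ i
  have hρi := fun i => integrable_relDensity (i := i) hΩ hV ha hab (hci i)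
  have hρ0 := fun i p => relDensity_nonneg hΩ hvol hα hβ hV hc.2.1 i p
  have hmem := ae_mem_spaceTime hΩ T
  have hρT : ∀ i, ∫⁻ p, ENNReal.ofReal (relDensity Ω α β V c i p) ∂(spaceTime Ω T) ≤
      ENNReal.ofReal (a⁻¹ * T) := fun i => by
    calc _ ≤ ∫⁻ p, ENNReal.ofReal a⁻¹ * ENNReal.ofReal (c i p) ∂(spaceTime Ω T) := by
          refine lintegral_mono_ae ?_
          filter_upwards [hmem] with p hp
          rw [← ENNReal.ofReal_mul (by positivity)]
          exact ENNReal.ofReal_le_ofReal (relDensity_le ha hab hc.2.1 hp.2 i)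
      _ ≤ _ := by
          rw [lintegral_const_mul' _ _ ENNReal.ofReal_ne_top, ENNReal.ofReal_mul (by positivity)]
          gcongr
          exact hc.lintegral_le hΩ hμ i
  refine ⟨c, J, b, G, hc, hJ, hG, ?_, ?_, ?_, ?_⟩
  · have : ∀ j, ∫ z, ‖J j z‖ ∂(spaceTime Ω T) ≤ MJ j := fun j => by
      refine integral_abs_le_of_lintegral (hJ0 j) (hJ.1 j).1.norm (fun _ => norm_nonneg _) ?_
      have hδj := (hδ j).le
      calc _ ≤ ∫⁻ p, (perspective quad (δ j * c j p) (J j p) +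
              ENNReal.ofReal (δ j) * ENNReal.ofReal (c j p)) ∂(spaceTime Ω T) := by
            refine lintegral_mono fun p => ?_
            rw [← ENNReal.ofReal_mul hδj]
            exact ofReal_norm_le_perspective_quad (mul_nonneg hδj (hc.2.1 j p)) _
        _ ≤ ENNReal.ofReal (C + 1) + ENNReal.ofReal (δ j) * ENNReal.ofReal T := by
            rw [lintegral_add_right _ ((hc.1 j).ennreal_ofReal.const_mul _),
              lintegral_const_mul' _ _ ENNReal.ofReal_ne_top]
            refine add_le_add (le_trans ?_ (le_self_add.trans hvel)) ?_
            · exact Finset.single_le_sum (f := fun j => ∫⁻ p, perspective quad (δ j * c j p)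
                (J j p) ∂(spaceTime Ω T)) (fun _ _ => zero_le) (Finset.mem_univ j)
            · gcongr
              exact hc.lintegral_le hΩ hμ j
        _ = ENNReal.ofReal (MJ j) := by
            rw [← ENNReal.ofReal_mul hδj, ← ENNReal.ofReal_add (by positivity) (by positivity)]
    have := Finset.sum_le_sum fun j (_ : j ∈ Finset.univ) => this j
    linarith
  · have hk : 0 < δ 0 * a := by positivity
    have : ∫ z, δ 0 * a * ‖G z‖ ∂(spaceTime Ω T) ≤ (C + 1) + δ 0 * a * (a⁻¹ * T) := by
      refine integral_abs_le_of_lintegral (by positivity) (hG.1.1.norm.const_mul _)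
        (fun _ => by positivity) ?_
      calc _ ≤ ∫⁻ p, (ENNReal.ofReal (δ 0 * tiltedStat Ω α β V 0 p.2) *
              perspective quad (relDensity Ω α β V c 0 p) (G p) +
              ENNReal.ofReal (δ 0 * a) * ENNReal.ofReal (relDensity Ω α β V c 0 p))
              ∂(spaceTime Ω T) := by
            refine lintegral_mono_ae ?_
            filter_upwards [hmem] with p hp
            rw [ENNReal.ofReal_mul hk.le]
            refine (mul_le_mul_right (ofReal_norm_le_perspective_quad (hρ0 0 p) (G p)) _).trans ?_
            rw [mul_add]
            gcongr
            exact (hab 0 _ hp.2).1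
        _ ≤ ENNReal.ofReal (C + 1) + ENNReal.ofReal (δ 0 * a) * ENNReal.ofReal (a⁻¹ * T) := by
            rw [lintegral_add_right' _ ((hρi 0).1.aemeasurable.ennreal_ofReal.const_mul _),
              lintegral_const_mul' _ _ ENNReal.ofReal_ne_top]
            gcongr
            exact hρT 0
        _ = _ := by
            rw [← ENNReal.ofReal_mul hk.le, ← ENNReal.ofReal_add (by positivity) (by positivity)]
    rw [integral_const_mul] at this
    have : ∫ z, ‖G z‖ ∂(spaceTime Ω T) ≤ MG := by
      rw [hMG, inv_mul_eq_div, le_div_iff₀ hk]; linarith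
    linarith
  · have : ∫ z, |relDensity Ω α β V c 0 z| ∂(spaceTime Ω T) ≤ a⁻¹ * T :=
      integral_abs_le_of_lintegral ht0 (hρi 0).1.norm (fun _ => abs_nonneg _) (by
        simpa only [abs_of_nonneg (hρ0 0 _)] using hρT 0)
    linarith
  -- The reactive slope makes the integral of `(√ρ₁ - √ρ₂)²` of order `ε`. With weight `√ε` in
  -- `abs_sub_le_of_sqrt`, both resulting terms are of order `√ε`.
  · have hs : 0 < Real.sqrt ε := Real.sqrt_pos.2 hε
    have : ∫ z, |relDensity Ω α β V c 0 z - relDensity Ω α β V c 1 z| ∂(spaceTime Ω T) ≤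
        MR * Real.sqrt ε := by
      refine integral_abs_le_of_lintegral (by positivity) ((hρi 0).sub (hρi 1)).1.norm
        (fun _ => abs_nonneg _) ?_
      calc _ ≤ ∫⁻ p, (ENNReal.ofReal (Real.sqrt ε * (4 * a)⁻¹ * (2 / ε)) * ENNReal.ofReal
              (Real.sqrt (tiltedStat Ω α β V 0 p.2 * tiltedStat Ω α β V 1 p.2) *
                (Real.sqrt (relDensity Ω α β V c 0 p) - Real.sqrt (relDensity Ω α β V c 1 p)) ^ 2) +
              ENNReal.ofReal (Real.sqrt ε) * (ENNReal.ofReal (relDensity Ω α β V c 0 p) +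
                ENNReal.ofReal (relDensity Ω α β V c 1 p))) ∂(spaceTime Ω T) := by
            refine lintegral_mono_ae ?_
            filter_upwards [hmem] with p hp
            have h0 := hab 0 _ hp.2
            have h1 := hab 1 _ hp.2
            have hsq : a ≤ Real.sqrt (tiltedStat Ω α β V 0 p.2 * tiltedStat Ω α β V 1 p.2) := by
              refine Real.le_sqrt_of_sq_le ?_
              rw [sq]
              exact mul_le_mul h0.1 h1.1 ha.le (ha.le.trans h0.1)
            rw [← ENNReal.ofReal_mul (by positivity), ← ENNReal.ofReal_add (hρ0 0 p) (hρ0 1 p),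
              ← ENNReal.ofReal_mul hs.le, ← ENNReal.ofReal_add (by positivity)
                (mul_nonneg hs.le (add_nonneg (hρ0 0 p) (hρ0 1 p)))]
            refine ENNReal.ofReal_le_ofReal ((abs_sub_le_of_sqrt (hρ0 0 p) (hρ0 1 p) hs).trans ?_)
            refine add_le_add_left ?_ _
            set D := (Real.sqrt (relDensity Ω α β V c 0 p) -
              Real.sqrt (relDensity Ω α β V c 1 p)) ^ 2 with hD
            have hD0 : 0 ≤ D := sq_nonneg _
            calc D / (2 * Real.sqrt ε) = Real.sqrt ε * (4 * a)⁻¹ * (2 / ε) * (a * D) := by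
                  obtain ⟨e, he, rfl⟩ : ∃ e, 0 < e ∧ ε = e ^ 2 := ⟨√ε, hs, (Real.sq_sqrt hε.le).symm⟩
                  rw [Real.sqrt_sq he.le]
                  field_simp; ring
              _ ≤ _ := by gcongr
        _ ≤ ENNReal.ofReal (Real.sqrt ε * (4 * a)⁻¹) * ENNReal.ofReal (C + 1) +
              ENNReal.ofReal (Real.sqrt ε) *
                (ENNReal.ofReal (a⁻¹ * T) + ENNReal.ofReal (a⁻¹ * T)) := by
            have hm0 := (hρi 0).1.aemeasurable.ennreal_ofReal
            have hm1 := (hρi 1).1.aemeasurable.ennreal_ofReal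
            have hm : AEMeasurable (fun p => ENNReal.ofReal (relDensity Ω α β V c 0 p) +
              ENNReal.ofReal (relDensity Ω α β V c 1 p)) (spaceTime Ω T) := hm0.add hm1
            rw [lintegral_add_right' _ (hm.const_mul _),
              lintegral_const_mul' _ _ ENNReal.ofReal_ne_top,
              lintegral_const_mul' _ _ ENNReal.ofReal_ne_top, lintegral_add_right' _ hm1,
              ENNReal.ofReal_mul (by positivity), mul_assoc]
            gcongr
            · exact hrea
            · exact hρT 0
            · exact hρT 1
        _ = _ := by
            rw [← ENNReal.ofReal_add ht0 ht0, ← ENNReal.ofReal_mul (by positivity),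
              ← ENNReal.ofReal_mul hs.le, ← ENNReal.ofReal_add (by positivity) (by positivity)]
            congr 1
            rw [hMR]; ring
    refine this.trans (mul_le_mul_of_nonneg_right ?_ hs.le)
    linarith

/-- The cylinder is exhausted by compact subsets of its interior. -/
theorem exists_isCompact_subset_measure_compl_le (hΩ : IsCompactDomain Ω) (T : ℝ) {κ : ℝ≥0∞}
    (hκ : κ ≠ 0) : ∃ K, IsCompact K ∧ K ⊆ Ioo 0 T ×ˢ interior Ω ∧ spaceTime Ω T Kᶜ ≤ κ := by
  -- The null boundary lets inner regularity of the open cylinder exhaust the closed one in measure.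
  have hint : interior Ω =ᵐ[volume] Ω := by
    refine interior_subset.eventuallyLE.antisymm ?_
    rw [ae_le_set, ← hΩ.isCompact.isClosed.frontier_eq]
    exact hΩ.volume_frontier
  have hO : (Ioo 0 T ×ˢ interior Ω : Set (ℝ × Space d)) =ᵐ[volume] (Icc 0 T ×ˢ Ω) :=
    Measure.set_prod_ae_eq Ioo_ae_eq_Icc hint
  have hlt : volume (Icc 0 T ×ˢ Ω) ≠ ⊤ := (isCompact_Icc.prod hΩ.isCompact).measure_lt_top.ne
  obtain ⟨K, hKO, hK, hlt'⟩ := (isOpen_Ioo.prod isOpen_interior).measurableSet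
    |>.exists_isCompact_sdiff_lt (by rw [measure_congr hO]; exact hlt) hκ
  refine ⟨K, hK, hKO, ?_⟩
  rw [spaceTime, ← Measure.restrict_congr_set hO,
    Measure.restrict_apply hK.measurableSet.compl, inter_comm, ← sdiff_eq]
  exact hlt'.le

/-- The energy bound prevents concentration on small sets. -/
theorem exists_measure_le_setIntegral_relDensity_le (hΩ : IsCompact Ω) (hvol : volume Ω = 1)
    (hT : 0 < T) (hα : 0 < α) (hβ : 0 < β) (hV : ∀ i, ContinuousOn (V i) Ω) (C : ℝ≥0) {κ : ℝ}
    (hκ : 0 < κ) : ∃ θ : ℝ≥0∞, θ ≠ 0 ∧ ∀ (μ : ℝ → Fin 2 → Measure (Space d))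
      (c : Fin 2 → ℝ × Space d → ℝ), IsDensity Ω T μ c →
      (∀ᵐ t ∂(volume.restrict (Icc 0 T)), IsState Ω (μ t)) →
      essSup (fun t => energy Ω α β (μ t)) (volume.restrict (Icc 0 T)) ≤ C →
      ∀ A : Set (ℝ × Space d), spaceTime Ω T A ≤ θ → ∀ i,
        ∫ z in A, |relDensity Ω α β V c i z| ∂(spaceTime Ω T) ≤ κ := by
  obtain ⟨a, b', ha, hab⟩ := exists_tiltedStat_bounds hΩ hvol hα hβ hV
  -- The energy term `η C T` and the constant term `R θ` are each made at most `κ a / 2`, then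
  -- multiplied by `a⁻¹`; the `+ 1` keeps `η` defined when `C = 0`.
  set η : ℝ := κ * a / (2 * (C * T + 1)) with hη
  have hη0 : 0 < η := by positivity
  set R : ℝ := η * Real.exp (1 / η) with hR
  have hR0 : 0 < R := by positivity
  clear_value η R
  refine ⟨ENNReal.ofReal (κ * a / (2 * R)), by
    rw [ne_eq, ENNReal.ofReal_eq_zero, not_le]; positivity, fun μ c hc hμ hE A hA i => ?_⟩
  have hci := hc.integrable hΩ hμ i
  have hw := statVec_pos hα hβ i
  refine integral_abs_le_of_lintegral hκ.le
    (integrable_relDensity hΩ hV ha hab hci).1.norm.restrict (fun _ => abs_nonneg _) ?_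
  calc _ ≤ ∫⁻ p in A, ENNReal.ofReal a⁻¹ * (ENNReal.ofReal η * ENNReal.ofReal
          (boltzmann (c i p / statVec α β i) * statVec α β i) + ENNReal.ofReal R)
          ∂(spaceTime Ω T) := by
        refine lintegral_mono_ae ?_
        filter_upwards [ae_restrict_of_ae (ae_mem_spaceTime hΩ T)] with p hp
        have hcp := hc.2.1 i p
        rw [abs_of_nonneg (relDensity_nonneg hΩ hvol hα hβ hV hc.2.1 i p)]
        refine (ENNReal.ofReal_le_ofReal (relDensity_le ha hab hc.2.1 hp.2 i)).trans ?_
        rw [ENNReal.ofReal_mul (by positivity), ← ENNReal.ofReal_mul hη0.le]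
        gcongr
        refine (ENNReal.ofReal_le_ofReal ?_).trans ENNReal.ofReal_add_le
        have h := mul_le_mul_of_nonneg_right
          (le_mul_boltzmann_add (div_nonneg hcp hw.le) hη0) hw.le
        rw [div_mul_cancel₀ _ hw.ne'] at h
        have h2 : R * statVec α β i ≤ R * 1 :=
          mul_le_mul_of_nonneg_left (statVec_le_one hα hβ i) hR0.le
        rw [← hR] at h
        linarith
    _ ≤ ENNReal.ofReal a⁻¹ * (ENNReal.ofReal η * (C * ENNReal.ofReal T) +
          ENNReal.ofReal R * ENNReal.ofReal (κ * a / (2 * R))) := by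
        rw [lintegral_const_mul' _ _ ENNReal.ofReal_ne_top, lintegral_add_right _ measurable_const,
          lintegral_const_mul' _ _ ENNReal.ofReal_ne_top, lintegral_const,
          Measure.restrict_apply_univ]
        gcongr
        exact (setLIntegral_le_lintegral _ _).trans (hc.lintegral_boltzmann_le hE i)
    _ = ENNReal.ofReal (a⁻¹ * (η * (C * T) + R * (κ * a / (2 * R)))) := by
        rw [ENNReal.ofReal_mul (by positivity), ENNReal.ofReal_add (by positivity) (by positivity),
          ENNReal.ofReal_mul hη0.le, ENNReal.ofReal_mul hR0.le, ENNReal.ofReal_mul C.coe_nonneg,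
          ENNReal.ofReal_coe_nnreal]
    _ ≤ ENNReal.ofReal κ := by
        refine ENNReal.ofReal_le_ofReal ?_
        have h1 : η * (C * T) ≤ κ * a / 2 := by
          have : η * (C * T + 1) = κ * a / 2 := by rw [hη]; field_simp
          linarith
        have h2 : R * (κ * a / (2 * R)) = κ * a / 2 := by field_simp
        rw [h2]
        calc a⁻¹ * (η * (C * T) + κ * a / 2) ≤ a⁻¹ * (κ * a / 2 + κ * a / 2) := by gcongr
          _ = κ := by field_simp; ring

end FastReaction

/-! ### Compactness of the relative density and the limit trajectory. -/

namespace FastReaction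

variable {d : ℕ} {Ω : Set (Space d)} {T α β : ℝ} {V : Fin 2 → Space d → ℝ}

/-- Extend `1 / W` continuously from `Ω` by Tietze and approximate it uniformly by a smooth
function. With `W = w₁^V + w₂^V` this yields a multiplier that keeps test functions smooth although
`1 / W` need not be. -/
theorem exists_contDiff_mul_sub_one_le (hΩ : IsCompact Ω) {W : Space d → ℝ}
    (hW : ContinuousOn W Ω) (hW0 : ∀ x ∈ Ω, 0 < W x) {κ : ℝ} (hκ : 0 < κ) :
    ∃ g : Space d → ℝ, ContDiff ℝ ∞ g ∧ ∀ x ∈ Ω, |g x * W x - 1| ≤ κ := by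
  obtain ⟨B, hB⟩ := hΩ.exists_bound_of_continuousOn hW
  set B' := max B 1 with hB'
  have hB0 : 0 < B' := lt_max_of_lt_right one_pos
  obtain ⟨h, hh⟩ := ContinuousMap.exists_restrict_eq hΩ.isClosed
    ⟨Ω.domRestrict fun x => (W x)⁻¹, (hW.inv₀ fun x hx => (hW0 x hx).ne').domRestrict⟩
  obtain ⟨g, hg, hgh, -⟩ := h.continuous.exists_contDiff_approx (⊤ : ℕ∞)
    (continuous_const (y := κ / B')) (fun _ => by positivity)
  refine ⟨g, hg, fun x hx => ?_⟩
  have hhx : h x = (W x)⁻¹ := congrArg (fun k : C(Ω, ℝ) => k ⟨x, hx⟩) hh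
  have h1 := (hgh x).le
  rw [Real.dist_eq, hhx] at h1
  have h2 : g x * W x - 1 = (g x - (W x)⁻¹) * W x := by
    rw [sub_mul, inv_mul_cancel₀ (hW0 x hx).ne']
  rw [h2, abs_mul]
  calc |g x - (W x)⁻¹| * |W x| ≤ κ / B' * B' := by
        gcongr
        exact (hB x hx).trans (le_max_left _ _)
    _ = κ := by field_simp

/-- Strong limits of densities of trajectories are densities of trajectories. -/
theorem isTrajectory_of_tendsto (hΩ : IsCompact Ω)
    {μ : ℕ → ℝ → Fin 2 → Measure (Space d)} {c : ℕ → Fin 2 → ℝ × Space d → ℝ}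
    (hμ : ∀ n, ∀ᵐ t ∂(volume.restrict (Icc 0 T)), IsState Ω (μ n t))
    (hc : ∀ n, IsDensity Ω T (μ n) (c n)) {c₀ : Fin 2 → ℝ × Space d → ℝ}
    (hm : ∀ i, Measurable (c₀ i)) (h0 : ∀ i p, 0 ≤ c₀ i p)
    (hi : ∀ i, Integrable (c₀ i) (spaceTime Ω T))
    (hlim : ∀ i, Tendsto (fun n => ∫ p, |c n i p - c₀ i p| ∂(spaceTime Ω T)) atTop (𝓝 0)) :
    IsTrajectory Ω T (fun t i => (volume.restrict Ω).withDensity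
      fun x => ENNReal.ofReal (c₀ i (t, x))) := by
  have := isFiniteMeasure_spaceTime hΩ T
  have hsec : ∀ i t, Measurable fun x => c₀ i (t, x) := fun i t =>
    (hm i).comp measurable_prodMk_left
  have hprod : ∀ {F : ℝ × Space d → ℝ}, Integrable F (spaceTime Ω T) →
      (∀ᵐ t ∂(volume.restrict (Icc 0 T)), IntegrableOn (fun x => F (t, x)) Ω) ∧
      Integrable (fun t => ∫ x in Ω, F (t, x)) (volume.restrict (Icc 0 T)) ∧
      ∫ p, F p ∂(spaceTime Ω T) = ∫ t in Icc 0 T, ∫ x in Ω, F (t, x) := fun {F} hF => by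
    rw [spaceTime_eq_prod] at hF ⊢
    exact ⟨hF.prod_right_ae, hF.integral_prod_left, integral_prod _ hF⟩
  -- The mass defect of the limit at time `t`. Its time integral is bounded by the `L¹` distance to
  -- `c n`, which has mass one, so it vanishes for a.e. `t`.
  set D : ℝ → ℝ := fun t => |(∑ i, ∫ x in Ω, c₀ i (t, x)) - 1| with hD
  have hDi : Integrable D (volume.restrict (Icc 0 T)) :=
    ((integrable_finsetSum _ fun i _ => (hprod (hi i)).2.1).sub (integrable_const _)).abs
  have hDle : ∀ n, ∫ t in Icc 0 T, D t ≤ ∑ i, ∫ p, |c n i p - c₀ i p| ∂(spaceTime Ω T) := by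
    intro n
    have hci := fun i => (hc n).integrable hΩ (hμ n) i
    have hdi : ∀ i, Integrable (fun p => |c n i p - c₀ i p|) (spaceTime Ω T) := fun i =>
      ((hci i).sub (hi i)).abs
    calc ∫ t in Icc 0 T, D t ≤ ∫ t in Icc 0 T, ∑ i, ∫ x in Ω, |c n i (t, x) - c₀ i (t, x)| := by
          refine integral_mono_ae hDi
            (integrable_finsetSum _ fun i _ => (hprod (hdi i)).2.1) ?_
          filter_upwards [(hc n).ae_sum_lintegral_eq_one hΩ (hμ n),
            ae_all_iff.2 fun i => (hprod (hci i)).1, ae_all_iff.2 fun i => (hprod (hi i)).1]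
            with t ht h1 h2
          have hone : ∑ i, ∫ x in Ω, c n i (t, x) = 1 := by
            have h3 : ∀ i, ∫ x in Ω, c n i (t, x) =
                (∫⁻ x in Ω, ENNReal.ofReal (c n i (t, x))).toReal := fun i =>
              integral_eq_lintegral_of_nonneg_ae
                (Eventually.of_forall fun x => (hc n).2.1 i _) (h1 i).1
            simp_rw [h3]
            rw [← ENNReal.toReal_sum, ht, ENNReal.toReal_one]
            intro i hi' htop
            rw [ENNReal.sum_eq_top.2 ⟨i, hi', htop⟩] at ht
            exact ENNReal.top_ne_one ht
          simp only [hD]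
          rw [← hone, ← Finset.sum_sub_distrib]
          refine (Finset.abs_sum_le_sum_abs _ _).trans (Finset.sum_le_sum fun i _ => ?_)
          rw [← integral_sub (h2 i) (h1 i)]
          refine abs_integral_le_integral_abs.trans_eq ?_
          simp_rw [abs_sub_comm]
      _ = _ := by
          rw [integral_finsetSum _ fun i _ => (hprod (hdi i)).2.1]
          exact Finset.sum_congr rfl fun i _ => (hprod (hdi i)).2.2.symm
  have hD0 : ∫ t in Icc 0 T, D t = 0 := by
    refine le_antisymm (ge_of_tendsto' (x := atTop) (f := fun n => ∑ i,
      ∫ p, |c n i p - c₀ i p| ∂(spaceTime Ω T)) ?_ hDle) (integral_nonneg fun _ => abs_nonneg _)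
    simpa using tendsto_finsetSum Finset.univ fun i _ => hlim i
  rw [integral_eq_zero_iff_of_nonneg (fun _ => abs_nonneg _) hDi] at hD0
  refine ⟨?_, fun i f hf => ?_⟩
  · filter_upwards [hD0, ae_all_iff.2 fun i => (hprod (hi i)).1] with t ht hti
    refine ⟨fun i => ?_, ?_⟩
    · refine withDensity_absolutelyContinuous _ _ ?_
      rw [Measure.restrict_apply hΩ.measurableSet.compl, compl_inter_self, measure_empty]
    · have h3 : ∀ i, (volume.restrict Ω).withDensity (fun x => ENNReal.ofReal (c₀ i (t, x))) Ω =
          ENNReal.ofReal (∫ x in Ω, c₀ i (t, x)) := fun i => by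
        rw [withDensity_apply _ hΩ.measurableSet, Measure.restrict_restrict hΩ.measurableSet,
          inter_self, ofReal_integral_eq_lintegral_ofReal (hti i)
            (Eventually.of_forall fun x => h0 i _)]
      simp_rw [h3]
      rw [← ENNReal.ofReal_sum_of_nonneg fun i _ => integral_nonneg fun x => h0 i _]
      have : ∑ i, ∫ x in Ω, c₀ i (t, x) = 1 := sub_eq_zero.1 (abs_eq_zero.1 ht)
      rw [this, ENNReal.ofReal_one]
  · refine StronglyMeasurable.aemeasurable (f := fun t => ∫ x, f x ∂((volume.restrict Ω).withDensity
      fun x => ENNReal.ofReal (c₀ i (t, x)))) ?_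
    have : ∀ t, ∫ x, f x ∂((volume.restrict Ω).withDensity
        fun x => ENNReal.ofReal (c₀ i (t, x))) = ∫ x in Ω, c₀ i (t, x) * f x := fun t => by
      rw [integral_withDensity_eq_integral_toReal_smul (hsec i t).ennreal_ofReal
        (Eventually.of_forall fun _ => ENNReal.ofReal_lt_top)]
      simp only [ENNReal.toReal_ofReal (h0 i _), smul_eq_mul]
    simp_rw [this]
    refine StronglyMeasurable.integral_prod_right (f := fun t x => c₀ i (t, x) * f x) ?_
    exact ((hm i).mul (hf.measurable.comp measurable_snd)).stronglyMeasurable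

/-- Compactness of the relative density of the first species. -/
theorem exists_subseq_tendsto_relDensity (hΩ : IsCompactDomain Ω) (hvol : volume Ω = 1) (hT : 0 < T)
    (hα : 0 < α) (hβ : 0 < β) (hV : ∀ i, ContinuousOn (V i) Ω) {ε : ℕ → ℝ}
    (hε0 : Tendsto ε atTop (𝓝 0)) {μ : ℕ → ℝ → Fin 2 → Measure (Space d)}
    (hμ : ∀ n, ∀ᵐ t ∂(volume.restrict (Icc 0 T)), IsState Ω (μ n t)) {C : ℝ≥0}
    (hE : ∀ n, essSup (fun t => energy Ω α β (μ n t)) (volume.restrict (Icc 0 T)) ≤ C)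
    {c : ℕ → Fin 2 → ℝ × Space d → ℝ} {J : ℕ → Fin 2 → ℝ × Space d → Space d}
    {b : ℕ → Fin 2 → ℝ × Space d → ℝ} {G : ℕ → ℝ × Space d → Space d}
    (hc : ∀ n, IsDensity Ω T (μ n) (c n)) (hJ : ∀ n, GCE Ω T (c n) (J n) (b n))
    (hG : ∀ n, IsWeakGradient Ω T (relDensity Ω α β V (c n) 0) (G n)) {M : ℝ} (hM0 : 0 ≤ M)
    (hJM : ∀ n, ∑ j, ∫ z, ‖J n j z‖ ∂(spaceTime Ω T) ≤ M)
    (hGM : ∀ n, ∫ z, ‖G n z‖ ∂(spaceTime Ω T) ≤ M)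
    (hρM : ∀ n, ∫ z, |relDensity Ω α β V (c n) 0 z| ∂(spaceTime Ω T) ≤ M)
    (hdM : ∀ n, ∫ z, |relDensity Ω α β V (c n) 0 z - relDensity Ω α β V (c n) 1 z|
      ∂(spaceTime Ω T) ≤ M * Real.sqrt (ε n)) :
    ∃ φ : ℕ → ℕ, StrictMono φ ∧ ∃ f₀ : ℝ × Space d → ℝ, Integrable f₀ (spaceTime Ω T) ∧
      Tendsto (fun n => ∫ z, |relDensity Ω α β V (c (φ n)) 0 z - f₀ z| ∂(spaceTime Ω T))
        atTop (𝓝 0) := by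
  have hΩc := hΩ.isCompact
  obtain ⟨a, b', ha, hab⟩ := exists_tiltedStat_bounds hΩc hvol hα hβ hV
  have hci := fun n i => (hc n).integrable hΩc (hμ n) i
  have hρi := fun n i => integrable_relDensity (i := i) hΩc hV ha hab (hci n i)
  refine exists_subseq_tendsto_integral_abs_sub hΩc (isOpen_Ioo.prod isOpen_interior)
    (prod_mono Ioo_subset_Icc_self interior_subset) (fun n => hρi n 0) hρM ?_ ?_ ?_
  · intro n Ψ v hΨ hΨc hΨ1 hO
    exact ((hG n).abs_integral_translate_sub_le (hρi n 0) hΨ hΨc hΨ1 hO).trans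
      (mul_le_mul_of_nonneg_right (hGM n) (norm_nonneg v))
  · intro κ hκ
    set W : Space d → ℝ := fun x => tiltedStat Ω α β V 0 x + tiltedStat Ω α β V 1 x with hW
    have hpos := tiltedStat_pos hΩc hvol hα hβ hV
    obtain ⟨g, hg, hgW⟩ := exists_contDiff_mul_sub_one_le hΩc (W := W)
      ((continuousOn_tiltedStat hV 0).add (continuousOn_tiltedStat hV 1))
      (fun x _ => add_pos (hpos 0 x) (hpos 1 x)) (κ := κ / (4 * (M + 1))) (by positivity)
    obtain ⟨B₁, hB₁⟩ := hΩc.exists_bound_of_continuousOn hg.continuous.continuousOn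
    obtain ⟨B₂, hB₂⟩ := hΩc.exists_bound_of_continuousOn
      (hg.continuous_fderiv (by simp)).continuousOn
    set B := max 0 (max B₁ B₂) with hB
    have hBb : ∀ x ∈ Ω, |g x| ≤ B ∧ ‖fderiv ℝ g x‖ ≤ B := fun x hx =>
      ⟨(hB₁ x hx).trans ((le_max_left _ _).trans (le_max_right _ _)),
        (hB₂ x hx).trans ((le_max_right _ _).trans (le_max_right _ _))⟩
    have hB0 : 0 ≤ B := le_max_left _ _
    have hlim : Tendsto (fun n => B * b' * (M * Real.sqrt (ε n))) atTop (𝓝 0) := by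
      have := ((Real.continuous_sqrt.tendsto 0).comp hε0).const_mul M |>.const_mul (B * b')
      simpa using this
    obtain ⟨N, hN⟩ := eventually_atTop.1
      -- One `κ / 4` goes to the error from `ρ₁ - ρ₂`, the other to the smooth approximation of `1 /
      -- W`; the time estimate doubles their sum.
      (hlim.eventually (ge_mem_nhds (show (0 : ℝ) < κ / 4 by positivity)))
    refine ⟨N, M * B, by positivity, fun n hn Ψ L s hΨ hΨc hΨ1 hL0 hL hO => ?_⟩
    refine ((hJ n).abs_integral_translate_sub_le_of_approx (hci n) (hρi n 0) hg hΩc hBb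
      (κ := κ / 2) ?_ (hJM n) hB0 hΨ hΨc hΨ1 hL0 hL hO).trans_eq (by ring)
    have hdi : Integrable (fun z => |relDensity Ω α β V (c n) 0 z - relDensity Ω α β V (c n) 1 z|)
        (spaceTime Ω T) := ((hρi n 0).sub (hρi n 1)).abs
    calc _ ≤ ∫ z, (|relDensity Ω α β V (c n) 0 z| * (κ / (4 * (M + 1))) +
            B * b' * |relDensity Ω α β V (c n) 0 z - relDensity Ω α β V (c n) 1 z|)
            ∂(spaceTime Ω T) := by
          refine integral_mono_of_nonneg (Eventually.of_forall fun _ => abs_nonneg _)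
            (((hρi n 0).abs.mul_const _).add (hdi.const_mul _)) ?_
          filter_upwards [ae_mem_spaceTime hΩc T] with z hz
          have e : ∀ i, c n i z = tiltedStat Ω α β V i z.2 * relDensity Ω α β V (c n) i z :=
            fun i => (mul_div_cancel₀ _ (hpos i z.2).ne').symm
          set r₀ := relDensity Ω α β V (c n) 0 z
          set r₁ := relDensity Ω α β V (c n) 1 z
          -- Substituting `c_i = w_i^V ρ_i` and writing `ρ₂ = ρ₁ - (ρ₁ - ρ₂)` separates the
          -- approximation error of `g` from the distance to equilibrium.
          have h1 : r₀ - g z.2 * (c n 0 z + c n 1 z) =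
              -(r₀ * (g z.2 * W z.2 - 1)) + g z.2 * tiltedStat Ω α β V 1 z.2 * (r₀ - r₁) := by
            rw [e 0, e 1, hW]; ring
          rw [h1]
          refine (abs_add_le _ _).trans (add_le_add ?_ ?_)
          · rw [abs_neg, abs_mul]
            exact mul_le_mul_of_nonneg_left (hgW _ hz.2) (abs_nonneg _)
          · rw [abs_mul, abs_mul, abs_of_pos (hpos 1 z.2)]
            refine mul_le_mul_of_nonneg_right ?_ (abs_nonneg _)
            exact mul_le_mul (hBb _ hz.2).1 (hab 1 _ hz.2).2 (hpos 1 z.2).le hB0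
      _ ≤ M * (κ / (4 * (M + 1))) + κ / 4 := by
          rw [integral_add ((hρi n 0).abs.mul_const _) (hdi.const_mul _), integral_mul_const,
            integral_const_mul]
          refine add_le_add (mul_le_mul_of_nonneg_right (hρM n) (by positivity))
            (le_trans ?_ (hN n hn))
          obtain ⟨x, hx⟩ : Ω.Nonempty := by
            rw [nonempty_iff_ne_empty]; rintro rfl; simp at hvol
          have hb0 : 0 ≤ b' := ha.le.trans ((hab 0 x hx).1.trans (hab 0 x hx).2)
          exact mul_le_mul_of_nonneg_left (hdM n) (by positivity)
      _ ≤ κ / 2 := by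
          have : M * (κ / (4 * (M + 1))) ≤ κ / 4 := by
            rw [mul_div_assoc', div_le_div_iff₀ (by positivity) (by positivity)]
            nlinarith
          linarith
  · intro κ hκ
    obtain ⟨θ, hθ, h⟩ := exists_measure_le_setIntegral_relDensity_le hΩc hvol hT hα hβ hV C hκ
    obtain ⟨K, hK, hKO, hKθ⟩ := exists_isCompact_subset_measure_compl_le hΩ T hθ
    exact ⟨K, hK, hKO, fun n => h (μ n) (c n) (hc n) (hμ n) (hE n) _ hKθ 0⟩

end FastReaction

open FastReaction in
theorem mainTheorem4 {d : ℕ} (Ω : Set (FastReaction.Space d))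
    (hΩ : FastReaction.IsCompactDomain Ω) (hvol : volume Ω = 1)
    (T : ℝ) (hT : 0 < T) (α β : ℝ) (hα : 0 < α) (hβ : 0 < β)
    (δ : Fin 2 → ℝ) (hδ : ∀ i, 0 < δ i)
    (V : Fin 2 → FastReaction.Space d → ℝ) (hV : ∀ i, FastReaction.IsC1On Ω (V i))
    (ε : ℕ → ℝ) (hε : ∀ n, 0 < ε n) (hε0 : Tendsto ε atTop (𝓝 0))
    (μ : ℕ → ℝ → Fin 2 → Measure (FastReaction.Space d))
    (hμ : ∀ n, FastReaction.IsTrajectory Ω T (μ n))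
    (C : ℝ≥0)
    (hE : ∀ n, essSup (fun t => FastReaction.energy Ω α β (μ n t))
      (volume.restrict (Icc 0 T)) ≤ C)
    (hD : ∀ n, FastReaction.dissipation Ω T α β δ V (ε n) (μ n) ≤ C) :
    ∃ c : ℕ → Fin 2 → ℝ × FastReaction.Space d → ℝ,
      (∀ n, FastReaction.IsDensity Ω T (μ n) (c n)) ∧
      ∃ (φ : ℕ → ℕ) (μ₀ : ℝ → Fin 2 → Measure (FastReaction.Space d))
        (c₀ : Fin 2 → ℝ × FastReaction.Space d → ℝ),
        StrictMono φ ∧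
        FastReaction.IsTrajectory Ω T μ₀ ∧ FastReaction.IsDensity Ω T μ₀ c₀ ∧
        (∀ i, Tendsto
          (fun n => eLpNorm (fun p => c (φ n) i p - c₀ i p) 1 (FastReaction.spaceTime Ω T))
          atTop (𝓝 0)) ∧
        ∀ᵐ p ∂(FastReaction.spaceTime Ω T),
          FastReaction.relDensity Ω α β V c₀ 0 p = FastReaction.relDensity Ω α β V c₀ 1 p := by
  have hΩc := hΩ.isCompact
  have hVc : ∀ i, ContinuousOn (V i) Ω := fun i => (hV i).1
  have hs : ∀ n, ∀ᵐ t ∂(volume.restrict (Icc 0 T)), IsState Ω (μ n t) := fun n => (hμ n).1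
  obtain ⟨a, b', ha, hab⟩ := exists_tiltedStat_bounds hΩc hvol hα hβ hVc
  have hpos := tiltedStat_pos hΩc hvol hα hβ hVc
  obtain ⟨M, hM0, hM⟩ := exists_uniform_estimates hΩc hvol hT hα hβ hδ hVc C
  choose c J b G hc hJ hG hJM hGM hρM hdM using fun n => hM (ε n) (μ n) (hε n) (hs n) (hD n)
  refine ⟨c, hc, ?_⟩
  obtain ⟨φ, hφ, f₀, hf₀, hlim⟩ := exists_subseq_tendsto_relDensity hΩ hvol hT hα hβ hVc hε0 hs hE
    hc hJ hG hM0 hJM hGM hρM hdM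
  have hci := fun n i => (hc n).integrable hΩc (hs n) i
  have hρi := fun n i => integrable_relDensity (i := i) hΩc hVc ha hab (hci n i)
  have hmem := ae_mem_spaceTime hΩc T
  have hω : ∀ i, Integrable (fun p : ℝ × Space d => tiltedStat Ω α β V i p.2 * f₀ p)
      (spaceTime Ω T) := fun i => by
    refine hf₀.bdd_mul (c := b') (aestronglyMeasurable_tiltedStat hΩc hVc i) ?_
    filter_upwards [hmem] with p hp
    rw [Real.norm_of_nonneg (hpos i p.2).le]
    exact (hab i _ hp.2).2
  -- Both species are built from the same `f₀`, which already forces equal relative densities. A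
  -- measurable representative and the positive part meet the pointwise demands of `IsDensity`.
  set c₀ : Fin 2 → ℝ × Space d → ℝ := fun i p => max 0 ((hω i).1.mk _ p) with hc₀
  have hc₀m : ∀ i, Measurable (c₀ i) := fun i =>
    measurable_const.max (hω i).1.stronglyMeasurable_mk.measurable
  have hc₀0 : ∀ i p, 0 ≤ c₀ i p := fun i p => le_max_left _ _
  have hc₀e : ∀ i, ∀ᵐ p ∂(spaceTime Ω T), c₀ i p = tiltedStat Ω α β V i p.2 * max 0 (f₀ p) := by
    intro i
    filter_upwards [(hω i).1.ae_eq_mk] with p hp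
    rw [hc₀]
    simp only
    rw [← hp, mul_max_of_nonneg _ _ (hpos i p.2).le, mul_zero]
  have hc₀i : ∀ i, Integrable (c₀ i) (spaceTime Ω T) := fun i => by
    refine (hω i).mono (hc₀m i).aestronglyMeasurable ?_
    filter_upwards [hc₀e i] with p hp
    rw [hp, norm_mul, norm_mul]
    refine mul_le_mul_of_nonneg_left ?_ (norm_nonneg _)
    rw [Real.norm_of_nonneg (le_max_left _ _), Real.norm_eq_abs]
    exact max_le (abs_nonneg _) (le_abs_self _)
  have hconv : ∀ i, Tendsto (fun n => ∫ p, |c (φ n) i p - c₀ i p| ∂(spaceTime Ω T))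
      atTop (𝓝 0) := fun i => by
    have hsq : Tendsto (fun n => b' * (M * Real.sqrt (ε (φ n)) +
        ∫ p, |relDensity Ω α β V (c (φ n)) 0 p - f₀ p| ∂(spaceTime Ω T))) atTop (𝓝 0) := by
      have h1 := ((Real.continuous_sqrt.tendsto 0).comp
        (hε0.comp hφ.tendsto_atTop)).const_mul M
      simpa using (h1.add hlim).const_mul b'
    refine squeeze_zero (fun n => integral_nonneg fun _ => abs_nonneg _) (fun n => ?_) hsq
    have hd : Integrable (fun p => |relDensity Ω α β V (c (φ n)) 0 p -
        relDensity Ω α β V (c (φ n)) 1 p|) (spaceTime Ω T) :=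
      ((hρi (φ n) 0).sub (hρi (φ n) 1)).abs
    have hd₀ : Integrable (fun p => |relDensity Ω α β V (c (φ n)) 0 p - f₀ p|) (spaceTime Ω T) :=
      ((hρi (φ n) 0).sub hf₀).abs
    obtain ⟨x, hx⟩ : Ω.Nonempty := by
      rw [nonempty_iff_ne_empty]; rintro rfl; simp at hvol
    have hb0 : 0 ≤ b' := ha.le.trans ((hab 0 x hx).1.trans (hab 0 x hx).2)
    calc _ ≤ ∫ p, b' * (|relDensity Ω α β V (c (φ n)) 0 p - relDensity Ω α β V (c (φ n)) 1 p| +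
            |relDensity Ω α β V (c (φ n)) 0 p - f₀ p|) ∂(spaceTime Ω T) := by
          refine integral_mono_of_nonneg (Eventually.of_forall fun _ => abs_nonneg _)
            ((hd.add hd₀).const_mul _) ?_
          filter_upwards [hc₀e i, hmem] with p hp hpΩ
          have e : c (φ n) i p = tiltedStat Ω α β V i p.2 * relDensity Ω α β V (c (φ n)) i p :=
            (mul_div_cancel₀ _ (hpos i p.2).ne').symm
          have hr0 := relDensity_nonneg hΩc hvol hα hβ hVc (hc (φ n)).2.1 i p
          rw [hp, e, ← mul_sub, abs_mul, abs_of_pos (hpos i p.2)]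
          refine mul_le_mul (hab i _ hpΩ.2).2 ?_ (abs_nonneg _) hb0
          -- Taking the positive part of the limit does not increase the distance, because the
          -- approximating densities are nonnegative.
          have h1 : |relDensity Ω α β V (c (φ n)) i p - max 0 (f₀ p)| ≤
              |relDensity Ω α β V (c (φ n)) i p - f₀ p| := by
            rcases le_total 0 (f₀ p) with h | h
            · rw [max_eq_right h]
            · rw [max_eq_left h, sub_zero, abs_of_nonneg hr0, abs_of_nonneg (by linarith)]
              linarith
          refine h1.trans ?_
          have h2 : i = 0 ∨ i = 1 := by omega
          rcases h2 with rfl | rfl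
          · exact le_add_of_nonneg_left (abs_nonneg _)
          -- The second species reaches `f₀` through the first by the triangle inequality, at the
          -- cost of the `M √ε` term.
          · rw [abs_sub_comm (relDensity Ω α β V (c (φ n)) 0 p) (relDensity _ _ _ _ _ 1 p)]
            exact abs_sub_le _ _ _
      _ ≤ _ := by
          rw [integral_const_mul, integral_add hd hd₀]
          exact mul_le_mul_of_nonneg_left (by gcongr; exact hdM (φ n)) hb0
  refine ⟨φ, _, c₀, hφ, isTrajectory_of_tendsto hΩc (fun n => hs (φ n)) (fun n => hc (φ n))
    hc₀m hc₀0 hc₀i hconv, ⟨hc₀m, hc₀0, Eventually.of_forall fun t i => rfl⟩, fun i => ?_, ?_⟩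
  · have h := ENNReal.tendsto_ofReal (hconv i)
    rw [ENNReal.ofReal_zero] at h
    refine h.congr fun n => ?_
    rw [eLpNorm_one_eq_lintegral_enorm]
    exact ofReal_integral_norm_eq_lintegral_enorm ((hci (φ n) i).sub (hc₀i i))
  · filter_upwards [hc₀e 0, hc₀e 1] with p h0 h1
    rw [relDensity, relDensity, h0, h1, mul_div_cancel_left₀ _ (hpos 0 p.2).ne',
      mul_div_cancel_left₀ _ (hpos 1 p.2).ne']
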